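/- Terms of the $\lambda\mu\rho\theta$-calculus, up to renaming of bound variables, are $M ::= x \mid \lambda x.M \mid (M\,M) \mid \mu\alpha.M \mid [\alpha]M$, with $\lambda$-variables $x$ and $\mu$-variables $\alpha$; $(H\,P_1\dots P_n)$ abbreviates $(\dots(H\,P_1)\dots P_n)$. Types are built from atoms and $\bot$ by $\to$, $\neg A = A\to\bot$, and the typing rules are those of simply typed $\lambda$-calculus together with: from $\Gamma,\alpha:\neg A\vdash M:A$ infer $\Gamma,\alpha:\neg A\vdash[\alpha]M:\bot$; from $\Gamma,\alpha:\neg A\vdash M:\bot$ infer $\Gamma\vdash\mu\alpha.M:A$. A term is typable if it has a type in some context. The reduction rules, applicable at any subterm occurrence, are - $\beta$: $(\lambda x.M)N\to M[x:=N]$; - $\mu$: $(\mu\alpha.M)N\to\mu\alpha.M[\alpha:=_rN]$, where every subterm $[\alpha]U$ of $M$ is recursively replaced by $[\alpha](U\,N)$; - $\rho$: $[\alpha]\mu\beta.M\to M[\beta:=\alpha]$; - $\theta$: $\mu\alpha.[\alpha]M\to M$ if $\alpha\notin Fv(M)$. A reduction sequence $M\mapsto^\sigma N$ is the list $\sigma$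 of contracted redex occurrences; its length is $|\sigma|$. A normal form is a term without redexes. A $\lambda\mu I$-term is a term in which, for every subterm $\lambda x.P$ (resp. $\mu\alpha.P$), $x$ (resp. $\alpha$) occurs free in $P$. The leftmost redex $lr(M)$ is given by: $lr(\lambda x.M)=lr(M)$; $lr(\mu\alpha.M)$ is $\mu\alpha.M$ if this is a $\theta$-redex and $lr(M)$ otherwise; $lr([\alpha]M)$ is $[\alpha]M$ if this is a $\rho$-redex and $lr(M)$ otherwise; $lr((\lambda x.M_1)M_2P_1\dots P_n)=(\lambda x.M_1)M_2$; $lr((\mu\alpha.M_1)M_2P_1\dots P_n)=(\mu\alpha.M_1)M_2$; $lr(x\,M_1\dots M_n)=lr(M_i)$ for the first $i$ with $M_i$ not normal. A leftmost reduction sequence contracts the leftmost redex at each step. Standard reduction sequences are defined inductively: $M\mapsto^\sigma N$ is standard if $\sigma$ is empty or one of the following holds. 1. $M=\lambda x.M_1$, $N=\lambda x.N_1$, and $\sigma$ is a standard sequence $M_1\mapsto N_1$ inside the body. 2. $M=\mu\alpha.M_1$, and either (a) no term of the sequence is itself a $\theta$-redex and $\sigma$ is a standard sequence $M_1\mapsto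 N_1$ in the body, $N=\mu\alpha.N_1$; or (b) $\sigma$ starts with a standard sequence $M_1\mapsto[\alpha]M'$ in the body, where $\mu\alpha.[\alpha]M'$ is the first term of the sequence that is itself a $\theta$-redex, followed either by the step $\mu\alpha.[\alpha]M'\to_\theta M'$ and a standard sequence $M'\mapsto N$, or by a standard sequence $M'\mapsto N'$ inside $\mu\alpha.[\alpha]M'$, $N=\mu\alpha.[\alpha]N'$. 3. $M=[\alpha]M_1$, and either (a) no term of the sequence is itself a $\rho$-redex and $\sigma$ is a standard sequence $M_1\mapsto N_1$ in the body, $N=[\alpha]N_1$; or (b) $\sigma$ starts with a standard sequence $M_1\mapsto\mu\beta.M'$ in the body, where $[\alpha]\mu\beta.M'$ is the first term of the sequence that is itself a $\rho$-redex, followed either by the step $[\alpha]\mu\beta.M'\to_\rho M'[\beta:=\alpha]$ and a standard sequence $M'[\beta:=\alpha]\mapsto N$, or by a standard sequence $M'\mapsto N'$ inside $[\alpha]\mu\beta.M'$, $N=[\alpha]\mu\beta.N'$. 4. $M=(\lambda x.M_1)M_2\dots M_n$ with $n\ge2$, and either $\sigma$ contracts $(\lambda x.M_1)M_2$ first and then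 continues with a standard sequence, or $N=(\lambda x.N_1)N_2\dots N_n$ and $\sigma$ is the concatenation of standard sequences $\lambda x.M_1\mapsto\lambda x.N_1$, $M_2\mapsto N_2$, ..., $M_n\mapsto N_n$ performed on the components in this order. 5. The same with $\mu\alpha.M_1$ in place of $\lambda x.M_1$ (and, in the second alternative, some $\mu$-abstraction $\mu\alpha.N_1$ in place of $\lambda x.N_1$). 6. $M=(x\,M_1\dots M_n)$, $N=(x\,N_1\dots N_n)$, and $\sigma$ is the concatenation of standard sequences $M_i\mapsto N_i$, $i=1,\dots,n$, performed on the arguments in this order. **Theorem.** Let $M$ be a typable $\lambda\mu I$-term and let $M\mapsto^\sigma N$ be a standard reduction sequence with $N$ a normal form. Then $\sigma$ is the leftmost reduction sequence from $M$ to $N$, and it is of maximal length: every reduction sequence $\tau$ starting from $M$ satisfies $|\tau|\le|\sigma|$. -/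

import Mathlib

/-! The simply typed lambda-mu-rho-theta calculus.

Terms modulo renaming of bound variables are represented by de Bruijn terms with two independent
families of indices, one for lambda-variables and one for mu-variables. -/

namespace LambdaMu

/-- Terms: `var x` is a lambda-variable, `lam M` is `λx.M`, `app M N` is `(M N)`, `mu M` is `μα.M`
and `named a M` is `[α]M`. A `lam` binds lambda-index `0`, a `mu` binds mu-index `0`. -/
inductive Term : Type
  | var (x : ℕ) : Term
  | lam (M : Term) : Term
  | app (M N : Term) : Term
  | mu (M : Term) : Term
  | named (a : ℕ) (M : Term) : Term

/-- Extension of a renaming of indices under one binder. -/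
def upRen (f : ℕ → ℕ) : ℕ → ℕ
  | 0 => 0
  | n + 1 => f n + 1

namespace Term

/-- Renaming of the free lambda-variables by `f` and of the free mu-variables by `g`. -/
def ren (f g : ℕ → ℕ) : Term → Term
  | var x => var (f x)
  | lam M => lam (ren (upRen f) g M)
  | app M N => app (ren f g M) (ren f g N)
  | mu M => mu (ren f (upRen g) M)
  | named a M => named (g a) (ren f g M)

/-- Weakening by one fresh lambda-variable. -/
def shiftLam (M : Term) : Term := ren Nat.succ id M

/-- Weakening by one fresh mu-variable. -/
def shiftMu (M : Term) : Term := ren id Nat.succ M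

/-- Extension of a substitution for lambda-variables under a `lam`. -/
def upSubst (s : ℕ → Term) : ℕ → Term
  | 0 => var 0
  | n + 1 => shiftLam (s n)

/-- Capture-avoiding simultaneous substitution for lambda-variables. -/
def subst (s : ℕ → Term) : Term → Term
  | var x => s x
  | lam M => lam (subst (upSubst s) M)
  | app M N => app (subst s M) (subst s N)
  | mu M => mu (subst (fun x => shiftMu (s x)) M)
  | named a M => named a (subst s M)

/-- `N` for index `0`; all other lambda-indices go down by one. -/
def single (N : Term) : ℕ → Term
  | 0 => N
  | n + 1 => var n

/-- The result of contracting `(λx.M) N`, i.e. `M[x := N]`. -/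
def betaContract (M N : Term) : Term := subst (single N) M

/-- `M[α :=ᵣ N]`: every subterm `[α]U` of `M` is replaced, recursively, by `[α](U N)`. -/
def muSubst (a : ℕ) (N : Term) : Term → Term
  | var x => var x
  | lam M => lam (muSubst a (shiftLam N) M)
  | app M P => app (muSubst a N M) (muSubst a N P)
  | mu M => mu (muSubst (a + 1) (shiftMu N) M)
  | named b M => named b (if b = a then app (muSubst a N M) N else muSubst a N M)

/-- The result of contracting `(μα.M) N`, i.e. `μα.M[α :=ᵣ N]`. -/
def muContract (M N : Term) : Term := mu (muSubst 0 (shiftMu N) M)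

/-- `a` for index `0`; all other mu-indices go down by one. -/
def singleRen (a : ℕ) : ℕ → ℕ
  | 0 => a
  | n + 1 => n

/-- The result of contracting `[α]μβ.M`, i.e. `M[β := α]`. -/
def rhoContract (a : ℕ) (M : Term) : Term := ren id (singleRen a) M

/-- The result of contracting `μα.[α]M` with `α` not free in `M`, i.e. `M` outside the scope of
the removed binder. -/
def thetaContract (M : Term) : Term := ren id Nat.pred M

/-- The lambda-variable `x` occurs free. -/
def FreeLam : ℕ → Term → Prop
  | x, var y => x = y
  | x, lam M => FreeLam (x + 1) M
  | x, app M N => FreeLam x M ∨ FreeLam x N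
  | x, mu M => FreeLam x M
  | x, named _ M => FreeLam x M

/-- The mu-variable `a` occurs free. -/
def FreeMu : ℕ → Term → Prop
  | _, var _ => False
  | a, lam M => FreeMu a M
  | a, app M N => FreeMu a M ∨ FreeMu a N
  | a, mu M => FreeMu (a + 1) M
  | a, named b M => a = b ∨ FreeMu a M

/-- `apps H [P₁, …, Pₙ]` is `(H P₁ … Pₙ)`. -/
def apps (H : Term) (Ps : List Term) : Term := Ps.foldl app H

/-- The λμI-terms: every abstracted variable occurs free in the body of the abstraction. -/
def IsLambdaMuI : Term → Prop
  | var _ => True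
  | lam M => IsLambdaMuI M ∧ FreeLam 0 M
  | app M N => IsLambdaMuI M ∧ IsLambdaMuI N
  | mu M => IsLambdaMuI M ∧ FreeMu 0 M
  | named _ M => IsLambdaMuI M

/-- A theta-redex is a term `μα.[α]M` with `α` not free in `M`. -/
def IsThetaRedex : Term → Prop
  | mu (named a M) => a = 0 ∧ ¬ FreeMu 0 M
  | _ => False

/-- A rho-redex is a term `[α]μβ.M`. -/
def IsRhoRedex : Term → Prop
  | named _ (mu _) => True
  | _ => False

end Term

open Term

/-- Simple types over countably many atoms and `⊥`. -/
inductive Ty : Type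
  | atom (n : ℕ) : Ty
  | bot : Ty
  | arrow (A B : Ty) : Ty

/-- `¬A` is `A → ⊥`. -/
def Ty.neg (A : Ty) : Ty := Ty.arrow A Ty.bot

/-- `HasType Γ Δ M A`: `M` has type `A` where the `x`-th entry of `Γ` is the declared type of the
lambda-variable `x`, and the `a`-th entry of `Δ` the declared (negated) type of the
mu-variable `a`. -/
inductive HasType : List Ty → List Ty → Term → Ty → Prop
  | ax {Γ Δ : List Ty} {x : ℕ} {A : Ty} (h : Γ[x]? = some A) : HasType Γ Δ (var x) A
  | arrowI {Γ Δ : List Ty} {M : Term} {A B : Ty} (h : HasType (A :: Γ) Δ M B) :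
      HasType Γ Δ (lam M) (Ty.arrow A B)
  | arrowE {Γ Δ : List Ty} {M N : Term} {A B : Ty} (hM : HasType Γ Δ M (Ty.arrow A B))
      (hN : HasType Γ Δ N A) : HasType Γ Δ (app M N) B
  | botI {Γ Δ : List Ty} {a : ℕ} {M : Term} {A : Ty} (ha : Δ[a]? = some A.neg)
      (h : HasType Γ Δ M A) : HasType Γ Δ (named a M) Ty.bot
  | muI {Γ Δ : List Ty} {M : Term} {A : Ty} (h : HasType Γ (A.neg :: Δ) M Ty.bot) :
      HasType Γ Δ (mu M) A

/-- `M` is typable: it has some type in some context. -/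
def Typable (M : Term) : Prop := ∃ Γ Δ A, HasType Γ Δ M A

/-- Directions into the immediate subterms: `down` into the body of `λ`, `μ` or `[α]`, `left` and
`right` into the function and the argument of an application. -/
inductive Dir : Type
  | down : Dir
  | left : Dir
  | right : Dir

/-- An occurrence of a subterm is the path that leads to it from the root. -/
abbrev Occ : Type := List Dir

open Dir

/-- `Step R M N`: `N` is obtained from `M` by contracting the redex at the occurrence `R`. (The
root constructors of the subterm at `R` determine the kind of the redex.) -/
inductive Step : Occ → Term → Term → Prop
  | beta (M N : Term) : Step [] (app (lam M) N) (betaContract M N)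
  | muRule (M N : Term) : Step [] (app (mu M) N) (muContract M N)
  | rho (a : ℕ) (M : Term) : Step [] (named a (mu M)) (rhoContract a M)
  | theta (M : Term) (h : ¬ FreeMu 0 M) : Step [] (mu (named 0 M)) (thetaContract M)
  | lam {R : Occ} {M M' : Term} (h : Step R M M') : Step (down :: R) (lam M) (lam M')
  | mu {R : Occ} {M M' : Term} (h : Step R M M') : Step (down :: R) (mu M) (mu M')
  | named {R : Occ} (a : ℕ) {M M' : Term} (h : Step R M M') :
      Step (down :: R) (named a M) (named a M')
  | appL {R : Occ} {M M' : Term} (N : Term) (h : Step R M M') :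
      Step (left :: R) (app M N) (app M' N)
  | appR {R : Occ} (M : Term) {N N' : Term} (h : Step R N N') :
      Step (right :: R) (app M N) (app M N')

/-- Normal forms: no occurrence is a redex. -/
def IsNormal (M : Term) : Prop := ∀ (R : Occ) (N : Term), ¬ Step R M N

/-- `Reduces M σ N`: the list `σ` of redex occurrences is a reduction sequence from `M` to `N`.
Its length is `σ.length`. -/
inductive Reduces : Term → List Occ → Term → Prop
  | nil (M : Term) : Reduces M [] M
  | cons {R : Occ} {σ : List Occ} {M M' N : Term} (h : Step R M M') (hs : Reduces M' σ N) :
      Reduces M (R :: σ) N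

/-- `LeftmostRedex M R`: the leftmost redex of `M` is the one at `R`. In `(H P₁ … Pₙ)` the
subterm `(H P₁)` is at `left` repeated `n - 1` times. -/
inductive LeftmostRedex : Term → Occ → Prop
  | lam {M : Term} {R : Occ} (h : LeftmostRedex M R) : LeftmostRedex (lam M) (down :: R)
  | theta {M : Term} (h : IsThetaRedex (mu M)) : LeftmostRedex (mu M) []
  | mu {M : Term} {R : Occ} (hn : ¬ IsThetaRedex (mu M)) (h : LeftmostRedex M R) :
      LeftmostRedex (mu M) (down :: R)
  | rho {a : ℕ} {M : Term} (h : IsRhoRedex (named a M)) : LeftmostRedex (named a M) []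
  | named {a : ℕ} {M : Term} {R : Occ} (hn : ¬ IsRhoRedex (named a M)) (h : LeftmostRedex M R) :
      LeftmostRedex (named a M) (down :: R)
  | headMu (M₁ M₂ : Term) (Ps : List Term) :
      LeftmostRedex (apps (app (mu M₁) M₂) Ps) (List.replicate Ps.length left)
  | headBeta (M₁ M₂ : Term) (Ps : List Term) :
      LeftmostRedex (apps (app (lam M₁) M₂) Ps) (List.replicate Ps.length left)
  | arg (x : ℕ) (Ps : List Term) (M : Term) (Qs : List Term) {R : Occ}
      (hPs : ∀ P ∈ Ps, IsNormal P) (hM : ¬ IsNormal M) (h : LeftmostRedex M R) :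
      LeftmostRedex (apps (var x) (Ps ++ M :: Qs))
        (List.replicate Qs.length left ++ right :: R)

/-- `LeftmostReduces M σ N`: `σ` is the leftmost reduction sequence from `M` to `N`, that is, each
step contracts the leftmost redex. -/
inductive LeftmostReduces : Term → List Occ → Term → Prop
  | nil (M : Term) : LeftmostReduces M [] M
  | cons {R : Occ} {σ : List Occ} {M M' N : Term} (hR : LeftmostRedex M R) (h : Step R M M')
      (hs : LeftmostReduces M' σ N) : LeftmostReduces M (R :: σ) N

/-- `within p σ`: the reduction sequence `σ` of a subterm, performed at the occurrence `p` of that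
subterm in a larger term. -/
def within (p : Occ) (σ : List Occ) : List Occ := σ.map (fun R => p ++ R)

/-- `NeverTheta M σ`: none of the terms of the reduction sequence `σ` from `M`, including `M` and
the last one, is such that putting `μα` in front of it yields a theta-redex. -/
def NeverTheta (M : Term) (σ : List Occ) : Prop :=
  ∀ (τ : List Occ) (P : Term), τ <+: σ → Reduces M τ P → ¬ IsThetaRedex (mu P)

/-- As `NeverTheta`, but nothing is required of the last term. -/
def NotBeforeTheta (M : Term) (σ : List Occ) : Prop :=
  ∀ (τ : List Occ) (P : Term), τ <+: σ → τ ≠ σ → Reduces M τ P → ¬ IsThetaRedex (mu P)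

/-- `NeverRho a M σ`: none of the terms of the reduction sequence `σ` from `M`, including `M` and
the last one, is such that putting `[a]` in front of it yields a rho-redex. -/
def NeverRho (a : ℕ) (M : Term) (σ : List Occ) : Prop :=
  ∀ (τ : List Occ) (P : Term), τ <+: σ → Reduces M τ P → ¬ IsRhoRedex (named a P)

/-- As `NeverRho`, but nothing is required of the last term. -/
def NotBeforeRho (a : ℕ) (M : Term) (σ : List Occ) : Prop :=
  ∀ (τ : List Occ) (P : Term), τ <+: σ → τ ≠ σ → Reduces M τ P → ¬ IsRhoRedex (named a P)

mutual

/-- `Standard M σ N`: `σ` is a standard reduction sequence from `M` to `N`. -/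
inductive Standard : Term → List Occ → Term → Prop
  | nil (M : Term) : Standard M [] M
  | lam {M N : Term} {σ : List Occ} (h : Standard M σ N) :
      Standard (lam M) (within [down] σ) (lam N)
  /-- No theta-redex at the root ever shows up. -/
  | mu {M N : Term} {σ : List Occ} (h : Standard M σ N) (hn : NeverTheta M σ) :
      Standard (mu M) (within [down] σ) (mu N)
  /-- The first theta-redex at the root is contracted as soon as it shows up. -/
  | muTheta {M M' N : Term} {σ₁ σ₂ : List Occ} (h₁ : Standard M σ₁ (named 0 M'))
      (hn : NotBeforeTheta M σ₁) (hM' : ¬ FreeMu 0 M') (h₂ : Standard (thetaContract M') σ₂ N) :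
      Standard (mu M) (within [down] σ₁ ++ [] :: σ₂) N
  /-- The first theta-redex at the root is kept, and all later steps are inside its body. -/
  | muKeep {M M' N' : Term} {σ₁ σ₂ : List Occ} (h₁ : Standard M σ₁ (named 0 M'))
      (hn : NotBeforeTheta M σ₁) (hM' : ¬ FreeMu 0 M') (h₂ : Standard M' σ₂ N') :
      Standard (mu M) (within [down] σ₁ ++ within [down, down] σ₂) (mu (named 0 N'))
  /-- No rho-redex at the root ever shows up. -/
  | named {a : ℕ} {M N : Term} {σ : List Occ} (h : Standard M σ N) (hn : NeverRho a M σ) :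
      Standard (named a M) (within [down] σ) (named a N)
  /-- The first rho-redex at the root is contracted as soon as it shows up. -/
  | namedRho {a : ℕ} {M M' N : Term} {σ₁ σ₂ : List Occ} (h₁ : Standard M σ₁ (mu M'))
      (hn : NotBeforeRho a M σ₁) (h₂ : Standard (rhoContract a M') σ₂ N) :
      Standard (named a M) (within [down] σ₁ ++ [] :: σ₂) N
  /-- The first rho-redex at the root is kept, and all later steps are inside its body. -/
  | namedKeep {a : ℕ} {M M' N' : Term} {σ₁ σ₂ : List Occ} (h₁ : Standard M σ₁ (mu M'))
      (hn : NotBeforeRho a M σ₁) (h₂ : Standard M' σ₂ N') :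
      Standard (named a M) (within [down] σ₁ ++ within [down, down] σ₂) (named a (mu N'))
  /-- `(λx.M₁) M₂ P₁ … Pₙ`, starting with the head redex. -/
  | headBeta {M₁ M₂ N : Term} {Ps : List Term} {σ : List Occ}
      (h : Standard (apps (betaContract M₁ M₂) Ps) σ N) :
      Standard (apps (app (lam M₁) M₂) Ps) (List.replicate Ps.length left :: σ) N
  /-- `(λx.M₁) P₁ … Pₙ` with `1 ≤ n`, reduced componentwise from left to right. -/
  | compLam {M₁ N₁ : Term} {Ps Qs : List Term} {σ τ : List Occ} (hPs : Ps ≠ [])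
      (h : Standard (lam M₁) σ (lam N₁)) (hs : StandardArgs Ps τ Qs) :
      Standard (apps (lam M₁) Ps) (within (List.replicate Ps.length left) σ ++ τ)
        (apps (lam N₁) Qs)
  /-- `(μα.M₁) M₂ P₁ … Pₙ`, starting with the head redex. -/
  | headMu {M₁ M₂ N : Term} {Ps : List Term} {σ : List Occ}
      (h : Standard (apps (muContract M₁ M₂) Ps) σ N) :
      Standard (apps (app (mu M₁) M₂) Ps) (List.replicate Ps.length left :: σ) N
  /-- `(μα.M₁) P₁ … Pₙ` with `1 ≤ n`, reduced componentwise from left to right. -/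
  | compMu {M₁ N₁ : Term} {Ps Qs : List Term} {σ τ : List Occ} (hPs : Ps ≠ [])
      (h : Standard (mu M₁) σ (mu N₁)) (hs : StandardArgs Ps τ Qs) :
      Standard (apps (mu M₁) Ps) (within (List.replicate Ps.length left) σ ++ τ)
        (apps (mu N₁) Qs)
  /-- `(x P₁ … Pₙ)`, reduced componentwise from left to right. -/
  | compVar {x : ℕ} {Ps Qs : List Term} {τ : List Occ} (hs : StandardArgs Ps τ Qs) :
      Standard (apps (var x) Ps) τ (apps (var x) Qs)

/-- `StandardArgs [P₁, …, Pₙ] τ [Q₁, …, Qₙ]`: `τ` is the concatenation of standard reduction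
sequences from `Pᵢ` to `Qᵢ`, for `i = 1, …, n` in this order, each performed at the occurrence of
the `i`-th argument in a term `(H P₁ … Pₙ)`, which is `left` repeated `n - i` times followed by
`right`. -/
inductive StandardArgs : List Term → List Occ → List Term → Prop
  | nil : StandardArgs [] [] []
  | cons {P Q : Term} {Ps Qs : List Term} {σ τ : List Occ} (h : Standard P σ Q)
      (hs : StandardArgs Ps τ Qs) :
      StandardArgs (P :: Ps) (within (List.replicate Ps.length left ++ [right]) σ ++ τ) (Q :: Qs)

end

end LambdaMu

namespace LambdaMu
open Term Dir

/-! ### Renaming and substitution -/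

-- Two independent facts are combined: leftmost reduction is longest, and a standard reduction to a
-- normal form is leftmost.
--
-- Length. In a λμI-term no contraction erases anything: free variables survive every step
-- (`Step.freeLam`, `Step.freeMu`), so the class is closed under reduction, and a step inside the
-- argument of a contracted β- or μ-redex leaves at least one copy behind. Comparing the leftmost
-- step `M → M'` with an arbitrary step `M → P` (`Lm.diamond`), either `M'` reduces to `P`, or `P`
-- has a leftmost reduct that `M'` reaches in at least one step. By strong induction, every step
-- from `M` strictly decreases the length of leftmost normalization (`LmLength.decrease`). That
-- length therefore bounds every reduction sequence. The delicate point is that a step may turn one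
-- redex into two successive ones (`Step.muSubst`), so residuals are counted as "one or more steps"
-- and never as exactly one.
--
-- Standard implies leftmost. A standard sequence departs from leftmost order only by keeping a
-- head, θ- or ρ-redex and working inside it, and such a redex then remains in the final term, which
-- cannot be normal. The recursion passes through initial segments that end, not at a normal form,
-- but at the first appearance of a θ- or ρ-redex around the term. The predicate `Reaches` covers
-- these ends too, and `Standard.leftmostReduces` is proved for it by mutual recursion with the
-- statement for argument lists.

theorem upRen_id : upRen id = id := by
  funext n; cases n <;> rfl

theorem upRen_comp (f f' : ℕ → ℕ) : upRen f' ∘ upRen f = upRen (f' ∘ f) := by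
  funext n; cases n <;> rfl

theorem upRen_eq_zero {f : ℕ → ℕ} {n : ℕ} : 0 = upRen f n ↔ n = 0 := by
  cases n <;> simp [upRen]

theorem upRen_eq_succ {f : ℕ → ℕ} {x n : ℕ} : x + 1 = upRen f n ↔ ∃ m, n = m + 1 ∧ x = f m := by
  cases n <;> simp [upRen]

namespace Term

theorem ren_id (M : Term) : ren id id M = M := by
  induction M <;> simp_all [ren, upRen_id]

theorem ren_ren (M : Term) (f g f' g' : ℕ → ℕ) :
    ren f' g' (ren f g M) = ren (f' ∘ f) (g' ∘ g) M := by
  induction M generalizing f g f' g' <;> simp_all [ren, upRen_comp]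

/-- Agreement on the free variables suffices. This is what allows renamings that differ only at the
binder removed by θ to be exchanged. -/
theorem ren_congr {M : Term} {f g f' g' : ℕ → ℕ} (hf : ∀ x, FreeLam x M → f x = f' x)
    (hg : ∀ a, FreeMu a M → g a = g' a) : ren f g M = ren f' g' M := by
  induction M generalizing f g f' g' with
  | var x => simp [ren, hf x rfl]
  | lam M ih =>
    simp only [ren]
    rw [ih (f' := upRen f') (g' := g')]
    · rintro (_ | x) hx
      · rfl
      · simp [upRen, hf x hx]
    · exact hg
  | app M N ihM ihN =>
    simp only [ren]
    rw [ihM (fun x h => hf x (Or.inl h)) (fun x h => hg x (Or.inl h)),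
      ihN (fun x h => hf x (Or.inr h)) (fun x h => hg x (Or.inr h))]
  | mu M ih =>
    simp only [ren]
    rw [ih (f' := f') (g' := upRen g')]
    · exact hf
    · rintro (_ | x) hx
      · rfl
      · simp [upRen, hg x hx]
  | named a M ih =>
    simp only [ren]
    rw [ih (fun x h => hf x h) (fun x h => hg x (Or.inr h)), hg a (Or.inl rfl)]

theorem shiftLam_ren (f g : ℕ → ℕ) (M : Term) :
    ren (upRen f) g (shiftLam M) = shiftLam (ren f g M) := by
  simp only [shiftLam, ren_ren]; rfl

theorem shiftMu_ren (f g : ℕ → ℕ) (M : Term) :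
    ren f (upRen g) (shiftMu M) = shiftMu (ren f g M) := by
  simp only [shiftMu, ren_ren]; rfl

/-- A substitution acts on lambda-variables only, so it absorbs `f`, while `g` has to stay on the
term. -/
theorem subst_ren (s : ℕ → Term) (f g : ℕ → ℕ) (M : Term) :
    subst s (ren f g M) = subst (s ∘ f) (ren id g M) := by
  induction M generalizing s f g with
  | var x => rfl
  | lam M ih =>
    simp only [ren, subst, upRen_id]
    rw [ih]
    congr 2
    funext n; cases n <;> rfl
  | app M N ihM ihN => simp only [ren, subst]; rw [ihM, ihN]
  | mu M ih => simp only [ren, subst]; rw [ih]; rfl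
  | named a M ih => simp only [ren, subst]; rw [ih]

theorem ren_subst (s : ℕ → Term) (f g : ℕ → ℕ) (M : Term) :
    ren f g (subst s M) = subst (fun x => ren f g (s x)) (ren id g M) := by
  induction M generalizing s f g with
  | var x => rfl
  | lam M ih =>
    simp only [ren, subst, upRen_id]
    rw [ih]
    congr 2
    funext n; cases n
    · rfl
    · simp [upSubst, shiftLam_ren]
  | app M N ihM ihN => simp only [ren, subst]; rw [ihM, ihN]
  | mu M ih => simp only [ren, subst]; rw [ih]; simp only [shiftMu_ren]
  | named a M ih => simp only [ren, subst]; rw [ih]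

theorem shiftLam_subst (t : ℕ → Term) (M : Term) :
    subst (upSubst t) (shiftLam M) = shiftLam (subst t M) := by
  simp only [shiftLam]; rw [subst_ren, ren_subst]; rfl

theorem shiftMu_subst (t : ℕ → Term) (M : Term) :
    subst (fun x => shiftMu (t x)) (shiftMu M) = shiftMu (subst t M) := by
  simp only [shiftMu]; rw [ren_subst]

theorem subst_subst (s t : ℕ → Term) (M : Term) :
    subst t (subst s M) = subst (fun x => subst t (s x)) M := by
  induction M generalizing s t with
  | var x => rfl
  | lam M ih =>
    simp only [subst]
    rw [ih]
    congr 2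
    funext n; cases n
    · rfl
    · simp [upSubst, shiftLam_subst]
  | app M N ihM ihN => simp only [subst]; rw [ihM, ihN]
  | mu M ih => simp only [subst]; rw [ih]; simp only [shiftMu_subst]
  | named a M ih => simp only [subst]; rw [ih]

theorem subst_var (M : Term) : subst var M = M := by
  have h : upSubst var = var := by funext n; cases n <;> rfl
  have h' : (fun x => shiftMu (var x)) = var := rfl
  induction M <;> simp_all [subst]

theorem subst_single_shiftLam (N M : Term) : subst (single N) (shiftLam M) = M := by
  rw [shiftLam, subst_ren, ren_id]
  exact subst_var M

/-! ### Free variables -/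

theorem freeLam_ren {f g : ℕ → ℕ} {M : Term} {x : ℕ} :
    FreeLam x (ren f g M) ↔ ∃ y, x = f y ∧ FreeLam y M := by
  induction M generalizing f g x with
  | var y => simp [ren, FreeLam]
  | lam M ih =>
    simp only [ren, FreeLam, ih, upRen_eq_succ]
    constructor
    · rintro ⟨_, ⟨m, rfl, rfl⟩, h⟩; exact ⟨m, rfl, h⟩
    · rintro ⟨m, rfl, h⟩; exact ⟨_, ⟨m, rfl, rfl⟩, h⟩
  | app M N ihM ihN => simp only [ren, FreeLam, ihM, ihN]; grind
  | mu M ih => simp only [ren, FreeLam, ih]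
  | named a M ih => simp only [ren, FreeLam, ih]

theorem freeMu_ren {f g : ℕ → ℕ} {M : Term} {a : ℕ} :
    FreeMu a (ren f g M) ↔ ∃ b, a = g b ∧ FreeMu b M := by
  induction M generalizing f g a with
  | var y => simp [ren, FreeMu]
  | lam M ih => simp only [ren, FreeMu, ih]
  | app M N ihM ihN => simp only [ren, FreeMu, ihM, ihN]; grind
  | mu M ih =>
    simp only [ren, FreeMu, ih, upRen_eq_succ]
    constructor
    · rintro ⟨_, ⟨m, rfl, rfl⟩, h⟩; exact ⟨m, rfl, h⟩
    · rintro ⟨m, rfl, h⟩; exact ⟨_, ⟨m, rfl, rfl⟩, h⟩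
  | named a M ih => simp only [ren, FreeMu, ih]; grind

theorem freeLam_shiftLam_succ {x : ℕ} {M : Term} :
    FreeLam (x + 1) (shiftLam M) ↔ FreeLam x M := by
  simp [shiftLam, freeLam_ren]

theorem freeLam_shiftMu {x : ℕ} {M : Term} : FreeLam x (shiftMu M) ↔ FreeLam x M := by
  simp [shiftMu, freeLam_ren]

theorem freeMu_shiftLam {a : ℕ} {M : Term} : FreeMu a (shiftLam M) ↔ FreeMu a M := by
  simp [shiftLam, freeMu_ren]

theorem freeMu_shiftMu_succ {a : ℕ} {M : Term} : FreeMu (a + 1) (shiftMu M) ↔ FreeMu a M := by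
  simp [shiftMu, freeMu_ren]

theorem not_freeMu_zero_shiftMu {M : Term} : ¬ FreeMu 0 (shiftMu M) := by
  simp [shiftMu, freeMu_ren]

theorem freeLam_subst {s : ℕ → Term} {M : Term} {x : ℕ} :
    FreeLam x (subst s M) ↔ ∃ y, FreeLam y M ∧ FreeLam x (s y) := by
  induction M generalizing s x with
  | var y => simp [subst, FreeLam]
  | lam M ih =>
    simp only [subst, FreeLam, ih]
    constructor
    · rintro ⟨_ | y, h, h'⟩
      · simp [upSubst, FreeLam] at h'
      · exact ⟨y, h, freeLam_shiftLam_succ.1 h'⟩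
    · rintro ⟨y, h, h'⟩; exact ⟨y + 1, h, freeLam_shiftLam_succ.2 h'⟩
  | app M N ihM ihN => simp only [subst, FreeLam, ihM, ihN]; grind
  | mu M ih => simp only [subst, FreeLam, ih, freeLam_shiftMu]
  | named a M ih => simp only [subst, FreeLam, ih]

theorem freeMu_subst {s : ℕ → Term} {M : Term} {a : ℕ} :
    FreeMu a (subst s M) ↔ FreeMu a M ∨ ∃ y, FreeLam y M ∧ FreeMu a (s y) := by
  induction M generalizing s a with
  | var y => simp [subst, FreeLam, FreeMu]
  | lam M ih =>
    simp only [subst, FreeLam, FreeMu, ih]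
    refine or_congr_right ?_
    constructor
    · rintro ⟨_ | y, h, h'⟩
      · simp [upSubst, FreeMu] at h'
      · exact ⟨y, h, freeMu_shiftLam.1 h'⟩
    · rintro ⟨y, h, h'⟩; exact ⟨y + 1, h, freeMu_shiftLam.2 h'⟩
  | app M N ihM ihN => simp only [subst, FreeLam, FreeMu, ihM, ihN]; grind
  | mu M ih => simp only [subst, FreeLam, FreeMu, ih, freeMu_shiftMu_succ]
  | named a M ih => simp only [subst, FreeLam, FreeMu, ih]; grind

theorem freeLam_muSubst {a : ℕ} {N M : Term} {x : ℕ} :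
    FreeLam x (muSubst a N M) ↔ FreeLam x M ∨ FreeMu a M ∧ FreeLam x N := by
  induction M generalizing a N x with
  | var y => simp [muSubst, FreeLam, FreeMu]
  | lam M ih => simp only [muSubst, FreeLam, FreeMu, ih, freeLam_shiftLam_succ]
  | app M P ihM ihP => simp only [muSubst, FreeLam, FreeMu, ihM, ihP]; grind
  | mu M ih => simp only [muSubst, FreeLam, FreeMu, ih, freeLam_shiftMu]
  | named b M ih =>
    by_cases h : b = a
    · simp only [muSubst, FreeLam, FreeMu, h, if_true, ih]; grind
    · simp only [muSubst, FreeLam, FreeMu, h, if_false, ih]; grind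

theorem freeMu_muSubst {a : ℕ} {N M : Term} {c : ℕ} :
    FreeMu c (muSubst a N M) ↔ FreeMu c M ∨ FreeMu a M ∧ FreeMu c N := by
  induction M generalizing a N c with
  | var y => simp [muSubst, FreeMu]
  | lam M ih => simp only [muSubst, FreeMu, ih, freeMu_shiftLam]
  | app M P ihM ihP => simp only [muSubst, FreeMu, ihM, ihP]; grind
  | mu M ih => simp only [muSubst, FreeMu, ih, freeMu_shiftMu_succ]
  | named b M ih =>
    by_cases h : b = a
    · simp only [muSubst, FreeMu, h, if_true, ih]; grind
    · simp only [muSubst, FreeMu, h, if_false, ih]; grind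

/-! ### Structural substitution -/

theorem muSubst_of_not_freeMu {a : ℕ} {N M : Term} (h : ¬ FreeMu a M) : muSubst a N M = M := by
  induction M generalizing a N with
  | var y => rfl
  | lam M ih => simp only [muSubst, ih (a := a) h]
  | app M P ihM ihP =>
    simp only [FreeMu, not_or] at h
    simp only [muSubst, ihM h.1, ihP h.2]
  | mu M ih => simp only [muSubst, ih (a := a + 1) h]
  | named b M ih =>
    simp only [FreeMu, not_or] at h
    simp only [muSubst, ih h.2, if_neg (Ne.symm h.1)]

/-- It is enough that no other name is identified with `a`. Full injectivity of `g` would exclude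
the renaming of a ρ-contraction. -/
theorem ren_muSubst {f g : ℕ → ℕ} {a : ℕ} (hg : ∀ b, g b = g a → b = a) (N M : Term) :
    ren f g (muSubst a N M) = muSubst (g a) (ren f g N) (ren f g M) := by
  induction M generalizing f g a N with
  | var y => rfl
  | lam M ih => simp only [muSubst, ren, ih hg, shiftLam_ren]
  | app M P ihM ihP => simp only [muSubst, ren, ihM hg, ihP hg]
  | mu M ih =>
    simp only [muSubst, ren]
    rw [ih, shiftMu_ren]; · rfl
    rintro (_ | b) h
    · simp [upRen] at h
    · simp only [upRen, Nat.add_right_cancel_iff] at h; rw [hg b h]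
  | named b M ih =>
    by_cases h : b = a
    · subst h; simp [muSubst, ren, ih hg]
    · have : g b ≠ g a := fun e => h (hg b e)
      simp [muSubst, ren, ih hg, h, this]

theorem shiftLam_muSubst (a : ℕ) (N M : Term) :
    muSubst a (shiftLam N) (shiftLam M) = shiftLam (muSubst a N M) :=
  (ren_muSubst (f := Nat.succ) (g := id) (a := a) (fun _ h => h) N M).symm

theorem shiftMu_muSubst (a : ℕ) (N M : Term) :
    muSubst (a + 1) (shiftMu N) (shiftMu M) = shiftMu (muSubst a N M) :=
  (ren_muSubst (f := id) (g := Nat.succ) (a := a) (fun _ h => Nat.succ_injective h) N M).symm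

/-- The resulting substitution `t` and the preimage `N'` are left as parameters so that one
induction serves both β-contraction, where `N'` is a lambda-shift of `N`, and substitution into a
μ-contraction, where `s` and `t` coincide. -/
theorem muSubst_subst {a : ℕ} {N N' : Term} {s t : ℕ → Term} (hs : ∀ x, muSubst a N (s x) = t x)
    (hN : subst t N' = N) (M : Term) :
    muSubst a N (subst s M) = subst t (muSubst a N' M) := by
  induction M generalizing a N N' s t with
  | var x => exact hs x
  | lam M ih =>
    simp only [subst, muSubst]
    rw [ih (t := upSubst t) (N' := shiftLam N')]
    · rintro (_ | x)
      · rfl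
      · simp only [upSubst, shiftLam_muSubst, hs]
    · rw [shiftLam_subst, hN]
  | app M P ihM ihP => simp only [subst, muSubst, ihM hs hN, ihP hs hN]
  | mu M ih =>
    simp only [subst, muSubst]
    rw [ih (t := fun x => shiftMu (t x)) (N' := shiftMu N')]
    · intro x; simp only [shiftMu_muSubst, hs]
    · rw [shiftMu_subst, hN]
  | named b M ih =>
    by_cases h : b = a
    · simp [muSubst, subst, ih hs hN, h, hN]
    · simp [muSubst, subst, ih hs hN, h]

/-- Substitution lemma for structural substitution. The copies of `N` inserted at `a` must not be
touched by the later substitution at `b`, whence `hN`. -/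
theorem muSubst_muSubst {a b : ℕ} (hab : a ≠ b) {N P : Term} (hN : ¬ FreeMu b N) (M : Term) :
    muSubst a N (muSubst b P M) = muSubst b (muSubst a N P) (muSubst a N M) := by
  induction M generalizing a b N P with
  | var x => rfl
  | lam M ih =>
    simp only [muSubst]
    rw [ih hab (by rwa [freeMu_shiftLam]), shiftLam_muSubst]
  | app M Q ihM ihQ => simp only [muSubst]; rw [ihM hab hN, ihQ hab hN]
  | mu M ih =>
    simp only [muSubst]
    rw [ih (by omega) (by rwa [freeMu_shiftMu_succ]), shiftMu_muSubst]
  | named c M ih =>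
    simp only [muSubst]
    rw [apply_ite (muSubst a N), apply_ite (muSubst b (muSubst a N P))]
    simp only [muSubst]
    rw [ih hab hN, muSubst_of_not_freeMu hN]
    by_cases h : c = a
    · have : c ≠ b := by omega
      simp [h, hab]
    · simp [h]

/-- When a renaming merges exactly the two names `b` and `c` into `a`, giving `N` to both before
merging is the same as giving it to `a` afterwards. This is the situation of `[a]μβ.M` under a
substitution for `a` itself. -/
theorem ren_muSubst_muSubst {f g : ℕ → ℕ} {a b c : ℕ} (hb : g b = a) (hc : g c = a) (hbc : b ≠ c)
    (hg : ∀ d, g d = a → d = b ∨ d = c) {N : Term} (hN : ¬ FreeMu b N) (M : Term) :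
    ren f g (muSubst b N (muSubst c N M)) = muSubst a (ren f g N) (ren f g M) := by
  induction M generalizing f g a b c N with
  | var x => rfl
  | lam M ih =>
    simp only [muSubst, ren]
    rw [ih hb hc hbc hg (by rwa [freeMu_shiftLam]), shiftLam_ren]
  | app M Q ihM ihQ => simp only [muSubst, ren]; rw [ihM hb hc hbc hg hN, ihQ hb hc hbc hg hN]
  | mu M ih =>
    simp only [muSubst, ren]
    rw [ih (a := a + 1) (by simp [upRen, hb]) (by simp [upRen, hc]) (by omega) _
      (by rwa [freeMu_shiftMu_succ]), shiftMu_ren]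
    rintro (_ | d) h
    · simp [upRen] at h
    · simp only [upRen, Nat.add_right_cancel_iff] at h ⊢; exact hg d h
  | named d M ih =>
    simp only [muSubst, ren]
    have := ih (f := f) hb hc hbc hg hN
    by_cases h : g d = a
    · rcases hg d h with rfl | rfl
      · simp [ren, this, hb, hbc]
      · simp [muSubst, ren, this, hc, hbc.symm, muSubst_of_not_freeMu hN]
    · have h1 : d ≠ b := by rintro rfl; exact h hb
      have h2 : d ≠ c := by rintro rfl; exact h hc
      simp [h, h1, h2, this]

/-! ### Preservation of the class of λμI-terms by substitution -/

theorem IsLambdaMuI.ren {M : Term} (h : IsLambdaMuI M) (f g : ℕ → ℕ) :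
    IsLambdaMuI (Term.ren f g M) := by
  induction M generalizing f g with
  | var x => trivial
  | lam M ih => exact ⟨ih h.1 _ _, freeLam_ren.2 ⟨0, rfl, h.2⟩⟩
  | app M N ihM ihN => exact ⟨ihM h.1 _ _, ihN h.2 _ _⟩
  | mu M ih => exact ⟨ih h.1 _ _, freeMu_ren.2 ⟨0, rfl, h.2⟩⟩
  | named a M ih => exact ih h _ _

theorem IsLambdaMuI.subst {M : Term} (h : IsLambdaMuI M) {s : ℕ → Term}
    (hs : ∀ x, IsLambdaMuI (s x)) : IsLambdaMuI (Term.subst s M) := by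
  induction M generalizing s with
  | var x => exact hs x
  | lam M ih =>
    refine ⟨ih h.1 ?_, freeLam_subst.2 ⟨0, h.2, rfl⟩⟩
    rintro (_ | x)
    · trivial
    · exact (hs x).ren _ _
  | app M N ihM ihN => exact ⟨ihM h.1 hs, ihN h.2 hs⟩
  | mu M ih => exact ⟨ih h.1 fun x => (hs x).ren _ _, freeMu_subst.2 (Or.inl h.2)⟩
  | named a M ih => exact ih h hs

theorem IsLambdaMuI.muSubst {M N : Term} (h : IsLambdaMuI M) (hN : IsLambdaMuI N) (a : ℕ) :
    IsLambdaMuI (Term.muSubst a N M) := by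
  induction M generalizing a N with
  | var x => trivial
  | lam M ih => exact ⟨ih h.1 (hN.ren _ _) _, freeLam_muSubst.2 (Or.inl h.2)⟩
  | app M P ihM ihP => exact ⟨ihM h.1 hN _, ihP h.2 hN _⟩
  | mu M ih => exact ⟨ih h.1 (hN.ren _ _) _, freeMu_muSubst.2 (Or.inl h.2)⟩
  | named b M ih =>
    simp only [Term.muSubst]
    split_ifs
    · exact ⟨ih h hN _, hN⟩
    · exact ih h hN _

end Term

/-! ### Contraction commutes with renaming and substitution -/

namespace Term

theorem ren_betaContract (f g : ℕ → ℕ) (M N : Term) :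
    ren f g (betaContract M N) = betaContract (ren (upRen f) g M) (ren f g N) := by
  simp only [betaContract]
  rw [ren_subst, subst_ren _ (upRen f)]
  congr 1
  funext n; cases n <;> rfl

theorem ren_muContract (f g : ℕ → ℕ) (M N : Term) :
    ren f g (muContract M N) = muContract (ren f (upRen g) M) (ren f g N) := by
  simp only [muContract, ren]
  rw [ren_muSubst fun b h => upRen_eq_zero.1 h.symm, shiftMu_ren]
  rfl

theorem ren_rhoContract (f g : ℕ → ℕ) (a : ℕ) (M : Term) :
    ren f g (rhoContract a M) = rhoContract (g a) (ren f (upRen g) M) := by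
  simp only [rhoContract, ren_ren]
  congr 1
  funext n; cases n <;> rfl

/-- `Nat.pred` sends the removed index `0` to the meaningless value `0`; the two sides agree because
that index does not occur. -/
theorem ren_thetaContract (f g : ℕ → ℕ) {M : Term} (h : ¬ FreeMu 0 M) :
    ren f g (thetaContract M) = thetaContract (ren f (upRen g) M) := by
  simp only [thetaContract, ren_ren]
  refine ren_congr (fun _ _ => rfl) ?_
  rintro (_ | a) ha
  · exact absurd ha h
  · rfl

theorem subst_betaContract (s : ℕ → Term) (M N : Term) :
    subst s (betaContract M N) = betaContract (subst (upSubst s) M) (subst s N) := by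
  simp only [betaContract, subst_subst]
  congr 1
  funext n; cases n
  · rfl
  · exact (subst_single_shiftLam _ _).symm

theorem subst_muContract (s : ℕ → Term) (M N : Term) :
    subst s (muContract M N) = muContract (subst (fun x => shiftMu (s x)) M) (subst s N) := by
  simp only [muContract, subst]
  rw [← muSubst_subst (N := shiftMu (subst s N))]
  · exact fun x => muSubst_of_not_freeMu not_freeMu_zero_shiftMu
  · exact shiftMu_subst s N

theorem ren_singleRen_shiftMu (a : ℕ) (M : Term) : ren id (singleRen a) (shiftMu M) = M := by
  rw [shiftMu, ren_ren]; exact ren_id M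

theorem ren_pred_shiftMu (M : Term) : ren id Nat.pred (shiftMu M) = M := by
  rw [shiftMu, ren_ren]; exact ren_id M

theorem subst_rhoContract (s : ℕ → Term) (a : ℕ) (M : Term) :
    subst s (rhoContract a M) = rhoContract a (subst (fun x => shiftMu (s x)) M) := by
  simp only [rhoContract]
  rw [ren_subst]
  simp only [ren_singleRen_shiftMu]

theorem subst_thetaContract (s : ℕ → Term) (M : Term) :
    subst s (thetaContract M) = thetaContract (subst (fun x => shiftMu (s x)) M) := by
  simp only [thetaContract]
  rw [ren_subst]
  simp only [ren_pred_shiftMu]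

theorem muSubst_betaContract (a : ℕ) (N M P : Term) :
    muSubst a N (betaContract M P) =
      betaContract (muSubst a (shiftLam N) M) (muSubst a N P) := by
  simp only [betaContract]
  refine muSubst_subst ?_ (subst_single_shiftLam _ _) M
  rintro (_ | x) <;> rfl

theorem muSubst_muContract (a : ℕ) (N M P : Term) :
    muSubst a N (muContract M P) =
      muContract (muSubst (a + 1) (shiftMu N) M) (muSubst a N P) := by
  simp only [muContract, muSubst]
  rw [muSubst_muSubst (by omega) not_freeMu_zero_shiftMu, shiftMu_muSubst]

theorem muSubst_rhoContract_of_ne {a b : ℕ} (h : b ≠ a) (N M : Term) :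
    muSubst a N (rhoContract b M) = rhoContract b (muSubst (a + 1) (shiftMu N) M) := by
  simp only [rhoContract]
  rw [ren_muSubst, ren_singleRen_shiftMu]; · rfl
  rintro (_ | c) hc
  · exact absurd hc h
  · exact congrArg _ hc

theorem muSubst_rhoContract_self (a : ℕ) (N M : Term) :
    muSubst a N (rhoContract a M) =
      rhoContract a (muSubst 0 (shiftMu N) (muSubst (a + 1) (shiftMu N) M)) := by
  simp only [rhoContract]
  rw [ren_muSubst_muSubst (a := a) rfl rfl (by omega) _ not_freeMu_zero_shiftMu,
    ren_singleRen_shiftMu]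
  rintro (_ | c) hc
  · exact Or.inl rfl
  · exact Or.inr (congrArg _ hc)

theorem muSubst_thetaContract {M : Term} (h : ¬ FreeMu 0 M) (a : ℕ) (N : Term) :
    muSubst a N (thetaContract M) = thetaContract (muSubst (a + 1) (shiftMu N) M) := by
  -- Since index `0` is absent, `M` is the weakening of its θ-contraction, and the claim becomes
  -- commutation with weakening.
  have hM : shiftMu (thetaContract M) = M := by
    rw [shiftMu, thetaContract, ren_ren]
    conv_rhs => rw [← ren_id M]
    refine ren_congr (fun _ _ => rfl) ?_
    rintro (_ | b) hb
    · exact absurd hb h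
    · rfl
  conv_rhs => rw [← hM]
  rw [shiftMu_muSubst]
  exact (ren_pred_shiftMu _).symm

theorem freeMu_thetaContract {M : Term} (h : ¬ FreeMu 0 M) {a : ℕ} :
    FreeMu a (thetaContract M) ↔ FreeMu (a + 1) M := by
  rw [thetaContract, freeMu_ren]
  constructor
  · rintro ⟨_ | b, rfl, hb⟩
    · exact absurd hb h
    · exact hb
  · exact fun hb => ⟨_, rfl, hb⟩

end Term

/-! ### Steps and free variables -/

theorem Step.freeLam {R : Occ} {M M' : Term} (h : Step R M M') (hI : M.IsLambdaMuI) {x : ℕ}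
    (hx : FreeLam x M) : FreeLam x M' := by
  induction h generalizing x with
  | beta M N =>
    refine freeLam_subst.2 ?_
    rcases hx with hx | hx
    · exact ⟨x + 1, hx, rfl⟩
    · exact ⟨0, hI.1.2, hx⟩
  | muRule M N =>
    refine freeLam_muSubst.2 ?_
    rcases hx with hx | hx
    · exact Or.inl hx
    · exact Or.inr ⟨hI.1.2, freeLam_shiftMu.2 hx⟩
  | rho a M => exact freeLam_ren.2 ⟨x, rfl, hx⟩
  | theta M h => exact freeLam_ren.2 ⟨x, rfl, hx⟩
  | lam h ih => exact ih hI.1 hx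
  | mu h ih => exact ih hI.1 hx
  | named a h ih => exact ih hI hx
  | appL N h ih => exact hx.imp_left (ih hI.1)
  | appR M h ih => exact hx.imp_right (ih hI.2)

theorem Step.freeMu {R : Occ} {M M' : Term} (h : Step R M M') (hI : M.IsLambdaMuI) {a : ℕ}
    (ha : FreeMu a M) : FreeMu a M' := by
  induction h generalizing a with
  | beta M N =>
    refine freeMu_subst.2 ?_
    rcases ha with ha | ha
    · exact Or.inl ha
    · exact Or.inr ⟨0, hI.1.2, ha⟩
  | muRule M N =>
    refine freeMu_muSubst.2 ?_
    rcases ha with ha | ha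
    · exact Or.inl ha
    · exact Or.inr ⟨hI.1.2, freeMu_shiftMu_succ.2 ha⟩
  | rho b M =>
    refine freeMu_ren.2 ?_
    rcases ha with rfl | ha
    -- The name in front disappears, but the bound `β` occurs in the body and is renamed to it.
    · exact ⟨0, rfl, hI.2⟩
    · exact ⟨a + 1, rfl, ha⟩
  | theta M h =>
    rcases ha with ha | ha
    · omega
    · exact (freeMu_thetaContract h).2 ha
  | lam h ih => exact ih hI.1 ha
  | mu h ih => exact ih hI.1 ha
  | named b h ih => exact Or.imp_right (ih hI) ha
  | appL N h ih => exact ha.imp_left (ih hI.1)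
  | appR M h ih => exact ha.imp_right (ih hI.2)

/-- Reduction creates no free variables, so a θ-redex stays one while its body is reduced. -/
theorem Step.freeMu_of_freeMu {R : Occ} {M M' : Term} (h : Step R M M') {a : ℕ}
    (ha : FreeMu a M') : FreeMu a M := by
  induction h generalizing a with
  | beta M N =>
    rcases freeMu_subst.1 ha with ha | ⟨_ | y, -, ha⟩
    · exact Or.inl ha
    · exact Or.inr ha
    · exact ha.elim
  | muRule M N =>
    rcases freeMu_muSubst.1 ha with ha | ha
    · exact Or.inl ha
    · exact Or.inr (freeMu_shiftMu_succ.1 ha.2)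
  | rho b M =>
    obtain ⟨_ | c, rfl, hc⟩ := freeMu_ren.1 ha
    · exact Or.inl rfl
    · exact Or.inr hc
  | theta M h => exact Or.inr ((freeMu_thetaContract h).1 ha)
  | lam h ih => exact ih ha
  | mu h ih => exact ih ha
  | named b h ih => exact Or.imp_right ih ha
  | appL N h ih => exact Or.imp_left ih ha
  | appR M h ih => exact Or.imp_right ih ha

theorem Step.isLambdaMuI {R : Occ} {M M' : Term} (h : Step R M M') (hI : M.IsLambdaMuI) :
    M'.IsLambdaMuI := by
  induction h with
  | beta M N =>
    refine hI.1.1.subst ?_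
    rintro (_ | x)
    · exact hI.2
    · trivial
  | muRule M N =>
    exact ⟨hI.1.1.muSubst (hI.2.ren _ _) _, freeMu_muSubst.2 (Or.inl hI.1.2)⟩
  | rho a M => exact hI.1.ren _ _
  | theta M h => exact hI.1.ren _ _
  | lam h ih => exact ⟨ih hI.1, h.freeLam hI.1 hI.2⟩
  | mu h ih => exact ⟨ih hI.1, h.freeMu hI.1 hI.2⟩
  | named a h ih => exact ih hI
  | appL N h ih => exact ⟨ih hI.1, hI.2⟩
  | appR M h ih => exact ⟨hI.1, ih hI.2⟩

/-! ### Steps under renaming and substitution -/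

theorem Step.ren {R : Occ} {M M' : Term} (h : Step R M M') (f g : ℕ → ℕ) :
    Step R (Term.ren f g M) (Term.ren f g M') := by
  induction h generalizing f g with
  | beta M N => rw [ren_betaContract]; exact .beta _ _
  | muRule M N => rw [ren_muContract]; exact .muRule _ _
  | rho a M => rw [ren_rhoContract]; exact .rho _ _
  | theta M h =>
    rw [ren_thetaContract f g h]
    refine .theta _ fun h0 => ?_
    obtain ⟨b, hb, hM⟩ := freeMu_ren.1 h0
    rw [upRen_eq_zero.1 hb] at hM
    exact h hM
  | lam h ih => exact .lam (ih _ _)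
  | mu h ih => exact .mu (ih _ _)
  | named a h ih => exact .named _ (ih _ _)
  | appL N h ih => exact .appL _ (ih _ _)
  | appR M h ih => exact .appR _ (ih _ _)

theorem Step.subst {R : Occ} {M M' : Term} (h : Step R M M') (s : ℕ → Term) :
    Step R (Term.subst s M) (Term.subst s M') := by
  induction h generalizing s with
  | beta M N => rw [subst_betaContract]; exact .beta _ _
  | muRule M N => rw [subst_muContract]; exact .muRule _ _
  | rho a M => rw [subst_rhoContract]; exact .rho _ _
  | theta M h =>
    rw [subst_thetaContract]
    refine .theta _ fun h0 => ?_
    rcases freeMu_subst.1 h0 with h0 | ⟨y, -, hy⟩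
    · exact h h0
    · exact not_freeMu_zero_shiftMu hy
  | lam h ih => exact .lam (ih _)
  | mu h ih => exact .mu (ih _)
  | named a h ih => exact .named _ (ih _)
  | appL N h ih => exact .appL _ (ih _)
  | appR M h ih => exact .appR _ (ih _)

/-! ### Many-step reduction -/

/-- One step, at some occurrence. -/
def StepTo (M N : Term) : Prop := ∃ R, Step R M N

/-- Reduction in zero or more steps. -/
abbrev Red : Term → Term → Prop := Relation.ReflTransGen StepTo

/-- Reduction in one or more steps. -/
abbrev RedPlus : Term → Term → Prop := Relation.TransGen StepTo

theorem Red.of_eq {M N : Term} (h : M = N) : Red M N := h ▸ .refl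

theorem StepTo.lam {M M' : Term} : StepTo M M' → StepTo (lam M) (lam M')
  | ⟨_, h⟩ => ⟨_, .lam h⟩

theorem StepTo.mu {M M' : Term} : StepTo M M' → StepTo (mu M) (mu M')
  | ⟨_, h⟩ => ⟨_, .mu h⟩

theorem StepTo.named (a : ℕ) {M M' : Term} : StepTo M M' → StepTo (named a M) (named a M')
  | ⟨_, h⟩ => ⟨_, .named a h⟩

theorem StepTo.appL (N : Term) {M M' : Term} : StepTo M M' → StepTo (app M N) (app M' N)
  | ⟨_, h⟩ => ⟨_, .appL N h⟩

theorem StepTo.appR (M : Term) {N N' : Term} : StepTo N N' → StepTo (app M N) (app M N')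
  | ⟨_, h⟩ => ⟨_, .appR M h⟩

theorem StepTo.ren (f g : ℕ → ℕ) {M M' : Term} :
    StepTo M M' → StepTo (Term.ren f g M) (Term.ren f g M')
  | ⟨_, h⟩ => ⟨_, h.ren f g⟩

theorem Red.app {M M' N N' : Term} (hM : Red M M') (hN : Red N N') :
    Red (app M N) (app M' N') :=
  (hM.lift (fun M => Term.app M N) fun _ _ => StepTo.appL N).trans
    (hN.lift (Term.app M') fun _ _ => StepTo.appR M')

theorem RedPlus.appL {M M' : Term} (N : Term) (hM : RedPlus M M') :
    RedPlus (app M N) (app M' N) :=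
  hM.lift (fun M => Term.app M N) fun _ _ => StepTo.appL N

theorem RedPlus.appR (M : Term) {N N' : Term} (hN : RedPlus N N') :
    RedPlus (app M N) (app M N') :=
  hN.lift (Term.app M) fun _ _ => StepTo.appR M

theorem RedPlus.lam {M M' : Term} (h : RedPlus M M') : RedPlus (lam M) (lam M') :=
  h.lift Term.lam fun _ _ => StepTo.lam

theorem RedPlus.mu {M M' : Term} (h : RedPlus M M') : RedPlus (mu M) (mu M') :=
  h.lift Term.mu fun _ _ => StepTo.mu

theorem RedPlus.named (a : ℕ) {M M' : Term} (h : RedPlus M M') :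
    RedPlus (named a M) (named a M') :=
  h.lift (Term.named a) fun _ _ => StepTo.named a

theorem Red.lam {M M' : Term} (h : Red M M') : Red (lam M) (lam M') :=
  h.lift Term.lam fun _ _ => StepTo.lam

theorem Red.mu {M M' : Term} (h : Red M M') : Red (mu M) (mu M') :=
  h.lift Term.mu fun _ _ => StepTo.mu

theorem Red.named (a : ℕ) {M M' : Term} (h : Red M M') : Red (named a M) (named a M') :=
  h.lift (Term.named a) fun _ _ => StepTo.named a

theorem Red.ren (f g : ℕ → ℕ) {M M' : Term} (h : Red M M') :
    Red (Term.ren f g M) (Term.ren f g M') :=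
  h.lift (Term.ren f g) fun _ _ => StepTo.ren f g

theorem RedPlus.ren (f g : ℕ → ℕ) {M M' : Term} (h : RedPlus M M') :
    RedPlus (Term.ren f g M) (Term.ren f g M') :=
  h.lift (Term.ren f g) fun _ _ => StepTo.ren f g

theorem Red.isLambdaMuI {M M' : Term} (h : Red M M') (hI : M.IsLambdaMuI) : M'.IsLambdaMuI := by
  induction h with
  | refl => exact hI
  | tail _ h ih => exact h.elim fun _ h => h.isLambdaMuI ih

-- Reduction inside the substituted terms, and of the term substituted into

theorem Red.subst {s s' : ℕ → Term} (hs : ∀ x, Red (s x) (s' x)) (M : Term) :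
    Red (Term.subst s M) (Term.subst s' M) := by
  induction M generalizing s s' with
  | var x => exact hs x
  | lam M ih =>
    refine Red.lam (ih ?_)
    rintro (_ | x)
    · exact .refl
    · exact (hs x).ren _ _
  | app M N ihM ihN => exact Red.app (ihM hs) (ihN hs)
  | mu M ih => exact Red.mu (ih fun x => (hs x).ren _ _)
  | named a M ih => exact Red.named a (ih hs)

theorem RedPlus.app_of_or {M M' N N' : Term} (hM : Red M M') (hN : Red N N')
    (h : RedPlus M M' ∨ RedPlus N N') : RedPlus (app M N) (app M' N') := by
  rcases h with h | h
  · exact (h.appL N).trans_left (Red.app .refl hN)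
  · exact (h.appR M).trans_left (Red.app hM .refl)

/-- An occurrence of `x` provides a copy in which at least one step is really made; this is where
the λμI-condition enters the count. -/
theorem RedPlus.subst {s s' : ℕ → Term} (hs : ∀ x, Red (s x) (s' x)) {M : Term} {x : ℕ}
    (hM : FreeLam x M) (hx : RedPlus (s x) (s' x)) :
    RedPlus (Term.subst s M) (Term.subst s' M) := by
  induction M generalizing s s' x with
  | var y => cases hM; exact hx
  | lam M ih =>
    refine RedPlus.lam (ih ?_ hM (hx.ren _ _))
    rintro (_ | x)
    · exact .refl
    · exact (hs x).ren _ _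
  | app M N ihM ihN =>
    exact RedPlus.app_of_or (Red.subst hs M) (Red.subst hs N)
      (hM.imp (fun h => ihM hs h hx) (fun h => ihN hs h hx))
  | mu M ih => exact RedPlus.mu (ih (fun x => (hs x).ren _ _) hM (hx.ren _ _))
  | named a M ih => exact RedPlus.named a (ih hs hM hx)

theorem Red.muSubst {N N' : Term} (hN : Red N N') (a : ℕ) (M : Term) :
    Red (Term.muSubst a N M) (Term.muSubst a N' M) := by
  induction M generalizing a N N' with
  | var x => exact .refl
  | lam M ih => exact Red.lam (ih (hN.ren _ _) _)
  | app M P ihM ihP => exact Red.app (ihM hN _) (ihP hN _)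
  | mu M ih => exact Red.mu (ih (hN.ren _ _) _)
  | named b M ih =>
    simp only [Term.muSubst]
    split_ifs
    · exact Red.named b (Red.app (ih hN _) hN)
    · exact Red.named b (ih hN _)

theorem RedPlus.muSubst {N N' : Term} (hN : RedPlus N N') {a : ℕ} {M : Term} (ha : FreeMu a M) :
    RedPlus (Term.muSubst a N M) (Term.muSubst a N' M) := by
  induction M generalizing a N N' with
  | var x => exact ha.elim
  | lam M ih => exact RedPlus.lam (ih (hN.ren _ _) ha)
  | app M P ihM ihP =>
    exact RedPlus.app_of_or (Red.muSubst hN.to_reflTransGen _ M)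
      (Red.muSubst hN.to_reflTransGen _ P) (ha.imp (ihM hN) (ihP hN))
  | mu M ih => exact RedPlus.mu (ih (hN.ren _ _) ha)
  | named b M ih =>
    simp only [Term.muSubst]
    split_ifs with h
    · exact RedPlus.named b (RedPlus.app_of_or (Red.muSubst hN.to_reflTransGen _ M)
        hN.to_reflTransGen (Or.inr hN))
    · exact RedPlus.named b (ih hN (ha.resolve_left (Ne.symm h)))

/-- One step may become two: the ρ-redex `[a]μβ.P` turns into `[a]((μβ.P') N)`, which needs a μ-step
before the ρ-step. All other steps remain single. -/
theorem Step.muSubst {R : Occ} {M M' : Term} (h : Step R M M') (a : ℕ) (N : Term) :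
    RedPlus (Term.muSubst a N M) (Term.muSubst a N M') := by
  induction h generalizing a N with
  | beta M P => rw [muSubst_betaContract]; exact .single ⟨_, .beta _ _⟩
  | muRule M P => rw [muSubst_muContract]; exact .single ⟨_, .muRule _ _⟩
  | rho b M =>
    simp only [Term.muSubst]
    split_ifs with h
    · subst h
      rw [muSubst_rhoContract_self]
      exact .tail (.single ⟨_, .named b (.muRule _ _)⟩) ⟨_, .rho _ _⟩
    · rw [muSubst_rhoContract_of_ne h]
      exact .single ⟨_, .rho _ _⟩
  | theta M h =>
    rw [muSubst_thetaContract h]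
    simp only [Term.muSubst, if_neg (Nat.succ_ne_zero a).symm]
    refine .single ⟨_, .theta _ fun h0 => ?_⟩
    rcases freeMu_muSubst.1 h0 with h0 | h0
    · exact h h0
    · exact not_freeMu_zero_shiftMu h0.2
  | lam h ih => exact RedPlus.lam (ih _ _)
  | mu h ih => exact RedPlus.mu (ih _ _)
  | named b h ih =>
    simp only [Term.muSubst]
    split_ifs
    · exact RedPlus.named b (RedPlus.appL _ (ih _ _))
    · exact RedPlus.named b (ih _ _)
  | appL P h ih => exact RedPlus.appL _ (ih _ _)
  | appR P h ih => exact RedPlus.appR _ (ih _ _)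


/-! ### Leftmost steps, structurally -/

/-- `M` is an application. -/
def IsApp : Term → Prop
  | app _ _ => True
  | _ => False

/-- `M` is of the form `(x P₁ … Pₙ)`. -/
def IsNeutral : Term → Prop
  | var _ => True
  | app M _ => IsNeutral M
  | _ => False

/-- `M` and `N` have the same outermost constructor, and the same name if this is `named`. -/
def SameTop : Term → Term → Prop
  | var _, var _ => True
  | lam _, lam _ => True
  | app _ _, app _ _ => True
  | mu _, mu _ => True
  | named a _, named b _ => a = b
  | _, _ => False

/-- `Lm M N`: `N` is obtained from `M` by contracting the leftmost redex. -/
inductive Lm : Term → Term → Prop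
  | beta (M N : Term) : Lm (app (lam M) N) (betaContract M N)
  | muRule (M N : Term) : Lm (app (mu M) N) (muContract M N)
  | rho (a : ℕ) (M : Term) : Lm (named a (mu M)) (rhoContract a M)
  | theta (M : Term) (h : ¬ FreeMu 0 M) : Lm (mu (named 0 M)) (thetaContract M)
  | lam {M M' : Term} (h : Lm M M') : Lm (lam M) (lam M')
  | mu {M M' : Term} (hn : ¬ IsThetaRedex (mu M)) (h : Lm M M') : Lm (mu M) (mu M')
  | named {a : ℕ} {M M' : Term} (hn : ¬ IsRhoRedex (named a M)) (h : Lm M M') :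
      Lm (named a M) (named a M')
  | appL {M M' : Term} (N : Term) (hM : IsApp M) (h : Lm M M') : Lm (app M N) (app M' N)
  | appR {M N N' : Term} (hM : IsNeutral M) (hn : IsNormal M) (h : Lm N N') :
      Lm (app M N) (app M N')

-- Application spines and the passage from occurrences to `Lm`

theorem isApp_app (M N : Term) : IsApp (app M N) := trivial

theorem apps_append_singleton (H : Term) (Ps : List Term) (Q : Term) :
    apps H (Ps ++ [Q]) = app (apps H Ps) Q := by
  simp [apps]

theorem apps_append (H : Term) (Ps Qs : List Term) :
    apps H (Ps ++ Qs) = apps (apps H Ps) Qs := by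
  simp [apps]

theorem isNeutral_apps_var (x : ℕ) (Ps : List Term) : IsNeutral (apps (var x) Ps) := by
  induction Ps using List.reverseRecOn with
  | nil => trivial
  | append_singleton Ps Q ih => rw [apps_append_singleton]; exact ih

theorem isApp_apps {H : Term} (hH : IsApp H) (Ps : List Term) : IsApp (apps H Ps) := by
  induction Ps using List.reverseRecOn with
  | nil => exact hH
  | append_singleton Ps Q ih => rw [apps_append_singleton]; trivial

theorem isNormal_var (x : ℕ) : IsNormal (var x) := by
  rintro R N ⟨⟩

theorem IsNeutral.isNormal_app {M N : Term} (hM : IsNeutral M) (hn : IsNormal M)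
    (hN : IsNormal N) : IsNormal (app M N) := by
  intro R P h
  cases h with
  | beta M N => exact hM
  | muRule M N => exact hM
  | appL N h => exact hn _ _ h
  | appR M h => exact hN _ _ h

theorem isNormal_apps_var (x : ℕ) {Ps : List Term} (h : ∀ P ∈ Ps, IsNormal P) :
    IsNormal (apps (var x) Ps) := by
  induction Ps using List.reverseRecOn with
  | nil => exact isNormal_var x
  | append_singleton Ps Q ih =>
    rw [apps_append_singleton]
    exact (isNeutral_apps_var x Ps).isNormal_app (ih fun P hP => h P (by simp [hP]))
      (h Q (by simp))

/-- A step of `(H P₁ … Pₙ)` at an occurrence inside of `H`. -/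
theorem Step.of_apps {H : Term} {Ps : List Term} {R : Occ} {P : Term} (hP : ¬ IsApp H → Ps = [])
    (h : Step (List.replicate Ps.length left ++ R) (apps H Ps) P) :
    ∃ H', Step R H H' ∧ P = apps H' Ps := by
  induction Ps using List.reverseRecOn generalizing P with
  | nil => exact ⟨P, h, rfl⟩
  | append_singleton Ps Q ih =>
    have hH : IsApp H := by by_contra hH; simpa using hP hH
    rw [apps_append_singleton] at h
    simp only [List.length_append, List.length_singleton, List.replicate_succ,
      List.cons_append] at h
    cases h with
    | appL _ h =>
      obtain ⟨H', h', rfl⟩ := ih (fun h => absurd hH h) h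
      exact ⟨H', h', (apps_append_singleton _ _ _).symm⟩

theorem Lm.apps {H H' : Term} (hH : IsApp H) (h : Lm H H') (Ps : List Term) :
    Lm (apps H Ps) (apps H' Ps) := by
  induction Ps using List.reverseRecOn with
  | nil => exact h
  | append_singleton Ps Q ih =>
    rw [apps_append_singleton, apps_append_singleton]
    exact .appL _ (isApp_apps hH Ps) ih

theorem LeftmostRedex.lm {M : Term} {R : Occ} (h : LeftmostRedex M R) {M' : Term}
    (hs : Step R M M') : Lm M M' := by
  induction h generalizing M' with
  | lam h ih => cases hs with | lam hs => exact .lam (ih hs)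
  | theta h => cases hs with
    | theta M hM => exact .theta _ hM
  | mu hn h ih => cases hs with | mu hs => exact .mu hn (ih hs)
  | rho h => cases hs with | rho a M => exact .rho _ _
  | named hn h ih => cases hs with | named a hs => exact .named hn (ih hs)
  | headMu M₁ M₂ Ps =>
    rw [← List.append_nil (List.replicate _ _)] at hs
    obtain ⟨H', h', rfl⟩ := hs.of_apps (fun h => absurd (isApp_app _ _) h)
    cases h'
    exact (Lm.muRule _ _).apps (isApp_app _ _) _
  | headBeta M₁ M₂ Ps =>
    rw [← List.append_nil (List.replicate _ _)] at hs
    obtain ⟨H', h', rfl⟩ := hs.of_apps (fun h => absurd (isApp_app _ _) h)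
    cases h'
    exact (Lm.beta _ _).apps (isApp_app _ _) _
  | arg x Ps M Qs hPs hM h ih =>
    -- Regrouping makes `(x Ps M)` an application at the head of the spine `Qs`, with the step in
    -- its last argument.
    have e : Ps ++ M :: Qs = Ps ++ [M] ++ Qs := by simp
    rw [e, apps_append, apps_append_singleton] at hs ⊢
    obtain ⟨H', h', rfl⟩ := hs.of_apps (fun h => absurd (isApp_app _ _) h)
    cases h' with
    | appR _ h' =>
      exact (Lm.appR (isNeutral_apps_var x Ps) (isNormal_apps_var x hPs) (ih h')).apps (isApp_app _ _) _

theorem Lm.stepTo {M M' : Term} (h : Lm M M') : StepTo M M' := by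
  induction h with
  | beta M N => exact ⟨_, .beta _ _⟩
  | muRule M N => exact ⟨_, .muRule _ _⟩
  | rho a M => exact ⟨_, .rho _ _⟩
  | theta M h => exact ⟨_, .theta _ h⟩
  | lam h ih => exact ih.lam
  | mu hn h ih => exact ih.mu
  | named hn h ih => exact ih.named _
  | appL N hM h ih => exact ih.appL _
  | appR hM hn h ih => exact ih.appR _

/-! ### The leftmost step against an arbitrary step -/

theorem SameTop.isApp {M P : Term} (h : SameTop M P) (hM : IsApp M) : IsApp P := by
  cases M <;> cases P <;> simp_all [SameTop, IsApp]

theorem SameTop.isRhoRedex {M P : Term} (h : SameTop M P) {a : ℕ}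
    (hP : IsRhoRedex (named a P)) : IsRhoRedex (named a M) := by
  cases M <;> cases P <;> simp_all [SameTop, IsRhoRedex]

theorem isThetaRedex_mu_iff {M : Term} :
    IsThetaRedex (mu M) ↔ ∃ P, M = named 0 P ∧ ¬ FreeMu 0 P := by
  cases M <;> simp [IsThetaRedex]

/-- A step under `μα` that keeps the top constructor creates no θ-redex around it: an occurrence of
`α` that blocks θ cannot be erased. -/
theorem SameTop.isThetaRedex {M P : Term} (h : SameTop M P) {R : Occ} (hs : Step R M P)
    (hI : M.IsLambdaMuI) (hP : IsThetaRedex (mu P)) : IsThetaRedex (mu M) := by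
  obtain ⟨Q, rfl, hQ⟩ := isThetaRedex_mu_iff.1 hP
  cases M with
  | named b M =>
    obtain rfl : b = 0 := h
    refine isThetaRedex_mu_iff.2 ⟨M, rfl, fun hM => hQ ?_⟩
    generalize hN : named 0 Q = N at hs
    cases hs with
    | named a hs => cases hN; exact hs.freeMu hI hM
    | rho a M =>
      cases M with
      | named c M =>
        simp only [rhoContract, ren, Term.named.injEq] at hN
        obtain ⟨hc, rfl⟩ := hN
        -- A ρ-step whose body again starts with a name `c`. If `c` is the inner bound variable, the
        -- blocking occurrence of the outer one lies deeper and survives; if `c` is the outer one,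
        -- the inner variable occurs deeper and is renamed to it.
        rcases c with _ | _ | c
        · exact freeMu_ren.2 ⟨1, rfl, hM.resolve_left (by omega)⟩
        · exact freeMu_ren.2 ⟨0, rfl, hI.2.resolve_left (by omega)⟩
        · simp [singleRen] at hc
      | _ => simp [rhoContract, ren] at hN
  | _ => exact h.elim

/-- The leftmost step commutes with every other step `M → P`, and the residual of the latter
takes at least one step unless `P` is reached after the leftmost step. -/
theorem Lm.diamond {M M' P : Term} (hI : M.IsLambdaMuI) (h : Lm M M') {R : Occ}
    (hs : Step R M P) :
    Red M' P ∨ SameTop M P ∧ ∃ P', Lm P P' ∧ RedPlus M' P' := by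
  induction h generalizing R P with
  | beta M N =>
    cases hs with
    | beta => exact .inl .refl
    | appL _ hs =>
      cases hs with
      | lam hs => exact .inr ⟨trivial, _, .beta _ _, .single ⟨_, hs.subst _⟩⟩
    | appR _ hs =>
      -- The bound variable occurs in the body, so the argument step has a residual.
      refine .inr ⟨trivial, _, .beta _ _, RedPlus.subst ?_ hI.1.2 (.single ⟨_, hs⟩)⟩
      rintro (_ | x)
      · exact .single ⟨_, hs⟩
      · exact .refl
  | muRule M N =>
    cases hs with
    | muRule => exact .inl .refl
    | appL _ hs =>
      cases hs with
      | mu hs => exact .inr ⟨trivial, _, .muRule _ _, RedPlus.mu (hs.muSubst _ _)⟩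
      | theta M hM =>
        -- Critical pair: `(μα.[α]M) N` contracts by μ to `μα.[α](M N)`, still a θ-redex, whose
        -- contraction is the result `M N` of the other step.
        refine .inl (.single ⟨[], ?_⟩)
        have hM' : ¬ FreeMu 0 (app M (shiftMu N)) := fun h =>
          h.elim hM not_freeMu_zero_shiftMu
        have := Step.theta _ hM'
        rw [muContract]
        simpa [muSubst, muSubst_of_not_freeMu hM, thetaContract, ren, ren_pred_shiftMu] using this
    | appR _ hs =>
      exact .inr ⟨trivial, _, .muRule _ _,
        RedPlus.mu (RedPlus.muSubst (.single ⟨_, hs.ren _ _⟩) hI.1.2)⟩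
  | rho a M =>
    cases hs with
    | rho => exact .inl .refl
    | named _ hs =>
      cases hs with
      | mu hs => exact .inr ⟨rfl, _, .rho _ _, .single ⟨_, hs.ren _ _⟩⟩
      | theta M hM =>
        -- Critical pair `[a]μα.[α]M`: both contractions give `[a]M`.
        refine .inl (Red.of_eq ?_)
        simp only [rhoContract, ren, thetaContract, singleRen]
        congr 1
        refine ren_congr (fun _ _ => rfl) ?_
        rintro (_ | b) hb
        · exact absurd hb hM
        · rfl
  | theta M hM =>
    cases hs with
    | theta => exact .inl .refl
    | mu hs =>
      cases hs with
      | named _ hs =>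
        exact .inr ⟨trivial, _, .theta _ fun h => hM (hs.freeMu_of_freeMu h),
          .single ⟨_, hs.ren _ _⟩⟩
      | rho _ M =>
        -- Critical pair `μα.[α]μβ.M`: both contractions give `μβ.M` up to renaming.
        refine .inl (Red.of_eq ?_)
        simp only [rhoContract, ren, thetaContract]
        congr 1
        refine ren_congr (fun _ _ => rfl) ?_
        rintro (_ | _ | b) hb
        · rfl
        · exact absurd hb hM
        · rfl
  | lam h ih =>
    cases hs with
    | lam hs =>
      rcases ih hI.1 hs with h | ⟨-, P', h, h'⟩
      · exact .inl h.lam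
      · exact .inr ⟨trivial, _, h.lam, h'.lam⟩
  | mu hn h ih =>
    cases hs with
    | theta _ hM => exact absurd (isThetaRedex_mu_iff.2 ⟨_, rfl, hM⟩) hn
    | mu hs =>
      rcases ih hI.1 hs with h | ⟨ht, P', h, h'⟩
      · exact .inl h.mu
      · exact .inr ⟨trivial, _, h.mu fun hP => hn (ht.isThetaRedex hs hI.1 hP), h'.mu⟩
  | named hn h ih =>
    cases hs with
    | rho => exact absurd trivial hn
    | named _ hs =>
      rcases ih hI hs with h | ⟨ht, P', h, h'⟩
      · exact .inl (h.named _)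
      · exact .inr ⟨rfl, _, h.named fun hP => hn (ht.isRhoRedex hP), h'.named _⟩
  | appL N hM h ih =>
    cases hs with
    | beta => exact hM.elim
    | muRule => exact hM.elim
    | appL _ hs =>
      rcases ih hI.1 hs with h | ⟨ht, P', h, h'⟩
      · exact .inl (h.app .refl)
      · exact .inr ⟨trivial, _, h.appL _ (ht.isApp hM), h'.appL _⟩
    | appR _ hs => exact .inr ⟨trivial, _, .appL _ hM h, .single ⟨_, .appR _ hs⟩⟩
  | appR hM hn h ih =>
    cases hs with
    | beta => exact hM.elim
    | muRule => exact hM.elim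
    | appL _ hs => exact absurd hs (hn _ _)
    | appR _ hs =>
      rcases ih hI.2 hs with h | ⟨-, P', h, h'⟩
      · exact .inl (Red.app .refl h)
      · exact .inr ⟨trivial, _, .appR hM hn h, h'.appR _⟩

/-! ### Leftmost reduction to normal form is maximal -/

/-- `LmLength n M`: some leftmost reduction of length `n` leads from `M` to a normal form. -/
inductive LmLength : ℕ → Term → Prop
  | zero {M : Term} (h : IsNormal M) : LmLength 0 M
  | succ {n : ℕ} {M M' : Term} (h : Lm M M') (hs : LmLength n M') : LmLength (n + 1) M

theorem LmLength.decrease {n : ℕ} {M P : Term} (hI : M.IsLambdaMuI) (h : LmLength n M)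
    (hs : StepTo M P) : ∃ m < n, LmLength m P := by
  induction n using Nat.strong_induction_on generalizing M P with
  | _ n ih =>
    obtain ⟨R, hs⟩ := hs
    cases h with
    | zero hn => exact absurd hs (hn _ _)
    | @succ n _ M' hl hn =>
      have hI' : M'.IsLambdaMuI := hl.stepTo.elim fun _ h => h.isLambdaMuI hI
      -- The induction hypothesis iterated along a reduction, which may be empty, so the decrease is
      -- only weak.
      have key : ∀ {k : ℕ} {A B : Term}, k < n + 1 → A.IsLambdaMuI → LmLength k A →
          Red A B → ∃ m ≤ k, LmLength m B := by
        intro k A B hk hA hkA hAB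
        induction hAB with
        | refl => exact ⟨k, le_rfl, hkA⟩
        | tail hAC hCB ihC =>
          obtain ⟨m, hm, hmC⟩ := ihC
          obtain ⟨m', hm', h⟩ := ih m (by omega) (Red.isLambdaMuI hAC hA) hmC hCB
          exact ⟨m', by omega, h⟩
      rcases hl.diamond hI hs with h | ⟨-, P', hP, hM'⟩
      · obtain ⟨m, hm, h⟩ := key (Nat.lt_succ_self n) hI' hn h
        exact ⟨m, by omega, h⟩
      -- The residual is nonempty: its first step gives a strict decrease, which pays for the extra
      -- leftmost step from `P` to `P'`.
      · obtain ⟨C, hC, hCP⟩ := Relation.TransGen.head'_iff.1 hM'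
        obtain ⟨m, hm, hmC⟩ := ih n (Nat.lt_succ_self n) hI' hn hC
        obtain ⟨m', hm', h⟩ := key (by omega) (Red.isLambdaMuI (.single hC) hI') hmC hCP
        exact ⟨m' + 1, by omega, .succ hP h⟩

theorem LmLength.length_le {n : ℕ} {M P : Term} {τ : List Occ} (hI : M.IsLambdaMuI)
    (h : LmLength n M) (hτ : Reduces M τ P) : τ.length ≤ n := by
  induction hτ generalizing n with
  | nil => exact Nat.zero_le _
  | cons hs _ ih =>
    obtain ⟨m, hm, h⟩ := h.decrease hI ⟨_, hs⟩
    have := ih (hs.isLambdaMuI hI) h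
    simp only [List.length_cons]
    omega

theorem LeftmostReduces.lmLength {M N : Term} {σ : List Occ} (h : LeftmostReduces M σ N)
    (hN : IsNormal N) : LmLength σ.length M := by
  induction h with
  | nil => exact .zero hN
  | cons hR h _ ih => exact .succ (hR.lm h) (ih hN)


/-! ### Reduction sequences inside a context -/

theorem Reduces.trans {M N P : Term} {σ τ : List Occ} (h : Reduces M σ N) (h' : Reduces N τ P) :
    Reduces M (σ ++ τ) P := by
  induction h with
  | nil => exact h'
  | cons hs _ ih => exact .cons hs (ih h')

theorem Reduces.lift {C : Term → Term} {p : Occ}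
    (hC : ∀ {R : Occ} {M N : Term}, Step R M N → Step (p ++ R) (C M) (C N))
    {M N : Term} {σ : List Occ} (h : Reduces M σ N) : Reduces (C M) (within p σ) (C N) := by
  induction h with
  | nil => exact .nil _
  | cons hs _ ih => exact .cons (hC hs) ih

theorem Reduces.isLambdaMuI {M N : Term} {σ : List Occ} (h : Reduces M σ N)
    (hI : M.IsLambdaMuI) : N.IsLambdaMuI := by
  induction h with
  | nil => exact hI
  | cons hs _ ih => exact ih (hs.isLambdaMuI hI)

theorem Reduces.freeMu {M N : Term} {σ : List Occ} (h : Reduces M σ N) (hI : M.IsLambdaMuI)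
    {a : ℕ} (ha : FreeMu a M) : FreeMu a N := by
  induction h with
  | nil => exact ha
  | cons hs _ ih => exact ih (hs.isLambdaMuI hI) (hs.freeMu hI ha)

theorem Reduces.freeMu_of_freeMu {M N : Term} {σ : List Occ} (h : Reduces M σ N) {a : ℕ}
    (ha : FreeMu a N) : FreeMu a M := by
  induction h with
  | nil => exact ha
  | cons hs _ ih => exact hs.freeMu_of_freeMu (ih ha)

theorem Reduces.eq_of_nil {M N : Term} (h : Reduces M [] N) : M = N := by
  cases h; rfl

theorem Step.apps_head {R : Occ} {H H' : Term} (h : Step R H H') (Ps : List Term) :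
    Step (List.replicate Ps.length left ++ R) (apps H Ps) (apps H' Ps) := by
  induction Ps using List.reverseRecOn with
  | nil => exact h
  | append_singleton Ps Q ih =>
    rw [apps_append_singleton, apps_append_singleton]
    simp only [List.length_append, List.length_singleton, List.replicate_succ, List.cons_append]
    exact .appL _ ih

theorem Step.apps_root {H H' : Term} (h : Step [] H H') (Ps : List Term) :
    Step (List.replicate Ps.length left) (apps H Ps) (apps H' Ps) := by
  simpa using h.apps_head Ps

theorem Step.apps_arg (H : Term) {R : Occ} {P Q : Term} (h : Step R P Q) (Ps : List Term) :
    Step (List.replicate Ps.length left ++ right :: R) (apps H (P :: Ps)) (apps H (Q :: Ps)) :=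
  (Step.appR H h).apps_head Ps

theorem StandardArgs.length_eq {Ps Qs : List Term} {τ : List Occ} (h : StandardArgs Ps τ Qs) :
    Ps.length = Qs.length :=
  match h with
  | .nil => rfl
  | .cons _ hs => congrArg (· + 1) hs.length_eq

mutual

theorem Standard.reduces {M N : Term} {σ : List Occ} (h : Standard M σ N) : Reduces M σ N :=
  match h with
  | .nil M => .nil M
  | .lam h => h.reduces.lift .lam
  | .mu h _ => h.reduces.lift .mu
  | .muTheta h₁ _ hM' h₂ => (h₁.reduces.lift .mu).trans (.cons (.theta _ hM') h₂.reduces)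
  | .muKeep h₁ _ _ h₂ =>
    (h₁.reduces.lift .mu).trans (h₂.reduces.lift (p := [down, down]) fun h => .mu (.named 0 h))
  | .named h _ => h.reduces.lift (.named _)
  | .namedRho h₁ _ h₂ => (h₁.reduces.lift (.named _)).trans (.cons (.rho _ _) h₂.reduces)
  | .namedKeep h₁ _ h₂ =>
    (h₁.reduces.lift (.named _)).trans
      (h₂.reduces.lift (p := [down, down]) fun h => .named _ (.mu h))
  | .headBeta h => .cons ((Step.beta _ _).apps_root _) h.reduces
  | .headMu h => .cons ((Step.muRule _ _).apps_root _) h.reduces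
  | .compLam _ h hs =>
    (h.reduces.lift (C := fun H => apps H _) fun h => h.apps_head _).trans (hs.reduces _)
  | .compMu _ h hs =>
    (h.reduces.lift (C := fun H => apps H _) fun h => h.apps_head _).trans (hs.reduces _)
  | .compVar hs => hs.reduces _

theorem StandardArgs.reduces {Ps Qs : List Term} {τ : List Occ} (h : StandardArgs Ps τ Qs)
    (H : Term) : Reduces (apps H Ps) τ (apps H Qs) :=
  match h with
  | .nil => .nil _
  | .cons h hs =>
    (h.reduces.lift (C := fun P => apps H (P :: _)) fun h => by
      simpa using h.apps_arg H _).trans (hs.reduces _)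

end

/-! ### Leftmost reduction sequences inside a context -/

theorem LeftmostReduces.trans {M N P : Term} {σ τ : List Occ} (h : LeftmostReduces M σ N)
    (h' : LeftmostReduces N τ P) : LeftmostReduces M (σ ++ τ) P := by
  induction h with
  | nil => exact h'
  | cons hR hs _ ih => exact .cons hR hs (ih h')

theorem LeftmostReduces.lam {M N : Term} {σ : List Occ} (h : LeftmostReduces M σ N) :
    LeftmostReduces (lam M) (within [down] σ) (lam N) := by
  induction h with
  | nil => exact .nil _
  | cons hR hs _ ih => exact .cons hR.lam hs.lam ih

theorem NotBeforeTheta.suffix {M N : Term} {σ τ : List Occ} (h : NotBeforeTheta M (σ ++ τ))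
    (hs : Reduces M σ N) : NotBeforeTheta N τ := fun ρ P hρ hne hP =>
  h (σ ++ ρ) P ((List.prefix_append_right_inj σ).2 hρ)
    (fun e => hne (List.append_cancel_left e)) (hs.trans hP)

theorem NotBeforeRho.suffix {a : ℕ} {M N : Term} {σ τ : List Occ}
    (h : NotBeforeRho a M (σ ++ τ)) (hs : Reduces M σ N) : NotBeforeRho a N τ :=
  fun ρ P hρ hne hP =>
    h (σ ++ ρ) P ((List.prefix_append_right_inj σ).2 hρ)
      (fun e => hne (List.append_cancel_left e)) (hs.trans hP)

theorem NotBeforeTheta.eq_nil {M : Term} {σ : List Occ} (h : NotBeforeTheta M σ)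
    (hM : IsThetaRedex (mu M)) : σ = [] := by
  by_contra hσ
  exact h [] M List.nil_prefix (Ne.symm hσ) (.nil M) hM

theorem NotBeforeRho.eq_nil {a : ℕ} {M : Term} {σ : List Occ} (h : NotBeforeRho a M σ)
    (hM : IsRhoRedex (named a M)) : σ = [] := by
  by_contra hσ
  exact h [] M List.nil_prefix (Ne.symm hσ) (.nil M) hM

theorem NeverTheta.notBefore {M : Term} {σ : List Occ} (h : NeverTheta M σ) :
    NotBeforeTheta M σ := fun τ P hτ _ => h τ P hτ

theorem NeverRho.notBefore {a : ℕ} {M : Term} {σ : List Occ} (h : NeverRho a M σ) :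
    NotBeforeRho a M σ := fun τ P hτ _ => h τ P hτ

/-- Only the terms from which a step departs must not form a θ-redex; the last one may. -/
theorem LeftmostReduces.mu {M N : Term} {σ : List Occ} (h : LeftmostReduces M σ N)
    (hn : NotBeforeTheta M σ) : LeftmostReduces (mu M) (within [down] σ) (mu N) := by
  induction h with
  | nil => exact .nil _
  | @cons R σ M M' N hR hs _ ih =>
    exact .cons (hR.mu fun h => List.cons_ne_nil _ _ (hn.eq_nil h)) hs.mu
      (ih (hn.suffix (σ := [R]) (.cons hs (.nil _))))

theorem LeftmostReduces.named {a : ℕ} {M N : Term} {σ : List Occ} (h : LeftmostReduces M σ N)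
    (hn : NotBeforeRho a M σ) :
    LeftmostReduces (named a M) (within [down] σ) (named a N) := by
  induction h with
  | nil => exact .nil _
  | @cons R σ M M' N hR hs _ ih =>
    exact .cons (hR.named fun h => List.cons_ne_nil _ _ (hn.eq_nil h)) (hs.named a)
      (ih (hn.suffix (σ := [R]) (.cons hs (.nil _))))

theorem LeftmostReduces.apps_arg (x : ℕ) {Ps : List Term} (hPs : ∀ P ∈ Ps, IsNormal P)
    {M N : Term} {σ : List Occ} (h : LeftmostReduces M σ N) (Qs : List Term) :
    LeftmostReduces (apps (var x) (Ps ++ M :: Qs))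
      (within (List.replicate Qs.length left ++ [right]) σ) (apps (var x) (Ps ++ N :: Qs)) := by
  induction h with
  | nil => exact .nil _
  | @cons R σ M M' N hR hs _ ih =>
    have e : List.replicate Qs.length left ++ [right] ++ R =
        List.replicate Qs.length left ++ right :: R := by simp
    refine .cons ?_ ?_ ih
    · beta_reduce; rw [e]; exact .arg x Ps M Qs hPs (fun hn => hn _ _ hs) hR
    · beta_reduce; rw [e, apps_append, apps_append]; exact hs.apps_arg _ Qs

/-! ### Standard reductions to normal form are leftmost -/

theorem apps_cons_isApp (H P : Term) (Ps : List Term) : IsApp (apps H (P :: Ps)) :=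
  isApp_apps (H := app H P) (isApp_app H P) Ps

theorem isNormal_of_apps {H : Term} {Ps : List Term} (h : IsNormal (apps H Ps)) :
    IsNormal H ∧ ∀ P ∈ Ps, IsNormal P := by
  induction Ps using List.reverseRecOn with
  | nil => exact ⟨h, by simp⟩
  | append_singleton Ps Q ih =>
    rw [apps_append_singleton] at h
    obtain ⟨hH, hPs⟩ := ih fun R N hs => h _ _ (.appL _ hs)
    refine ⟨hH, fun P hP => ?_⟩
    rcases List.mem_append.1 hP with hP | hP
    · exact hPs P hP
    · obtain rfl := List.mem_singleton.1 hP
      exact fun R N hs => h _ _ (.appR _ hs)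

theorem isLambdaMuI_apps {H : Term} {Ps : List Term} :
    (apps H Ps).IsLambdaMuI ↔ H.IsLambdaMuI ∧ ∀ P ∈ Ps, P.IsLambdaMuI := by
  induction Ps using List.reverseRecOn with
  | nil => simp [apps]
  | append_singleton Ps Q ih =>
    rw [apps_append_singleton]
    simp only [IsLambdaMuI, ih, List.mem_append, List.mem_singleton]
    grind

/-- The reduction sequence `σ` from `M` ends with `N` when it reaches for the first time a
normal form, or a `μ`-abstraction, or the body of a theta-redex. -/
def Reaches (M : Term) (σ : List Occ) (N : Term) : Prop :=
  IsNormal N ∨ (∃ a N', N = mu N' ∧ NotBeforeRho a M σ) ∨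
    (IsThetaRedex (mu N) ∧ NotBeforeTheta M σ)

theorem Reaches.suffix {M M' N : Term} {σ τ : List Occ} (h : Reaches M (σ ++ τ) N)
    (hs : Reduces M σ M') : Reaches M' τ N :=
  h.imp_right fun h => h.imp
    (fun ⟨a, N', e, h⟩ => ⟨a, N', e, h.suffix hs⟩) (fun h => ⟨h.1, h.2.suffix hs⟩)

theorem Reaches.isNormal {M N : Term} {σ : List Occ} (h : Reaches M σ N) (hmu : ∀ P, N ≠ mu P)
    (hnamed : ∀ a P, N ≠ named a P) : IsNormal N := by
  rcases h with h | ⟨_, _, h, -⟩ | ⟨h, -⟩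
  · exact h
  · exact absurd h (hmu _)
  · obtain ⟨P, rfl, -⟩ := isThetaRedex_mu_iff.1 h
    exact absurd rfl (hnamed _ _)

theorem Reaches.isNormal_of_isApp {M N : Term} {σ : List Occ} (h : Reaches M σ N)
    (hN : IsApp N) : IsNormal N :=
  h.isNormal (by rintro P rfl; exact hN) (by rintro a P rfl; exact hN)

/-- A sequence that stops at its first `μ`-abstraction and starts at one is empty. -/
theorem Reaches.mu {M N : Term} {σ : List Occ} (h : Reaches (mu M) σ (mu N)) :
    σ = [] ∨ IsNormal (mu N) := by
  rcases h with h | ⟨a, _, -, h⟩ | ⟨h, -⟩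
  · exact .inr h
  · exact .inl (h.eq_nil trivial)
  · exact h.elim

/-- If the end is the body of a θ-redex, so is the start, because a free name of `M` would persist
in `N`; stopping at the first such body then forces the sequence to be empty. -/
theorem Reaches.named {a : ℕ} {M N : Term} {σ : List Occ}
    (h : Reaches (named a M) σ (named a N)) (hI : M.IsLambdaMuI) {τ : List Occ}
    (hs : Reduces M τ N) : σ = [] ∨ IsNormal (named a N) := by
  rcases h with h | ⟨_, _, h, -⟩ | ⟨h, h'⟩
  · exact .inr h
  · cases h
  · exact .inl (h'.eq_nil ⟨h.1, fun ha => h.2 (hs.freeMu hI ha)⟩)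

theorem not_isNormal_apps_app {H P H' : Term} (h : Step [] (app H P) H') (Ps : List Term) :
    ¬ IsNormal (apps H (P :: Ps)) := fun hn => (isNormal_of_apps (H := app H P) hn).1 _ _ h

theorem LeftmostReduces.of_nil {M N : Term} {σ : List Occ} (h : Reduces M σ N) (hσ : σ = []) :
    LeftmostReduces M σ N := by
  subst hσ
  obtain rfl := h.eq_of_nil
  exact .nil _

mutual

theorem Standard.leftmostReduces {M N : Term} {σ : List Occ} (h : Standard M σ N)
    (hI : M.IsLambdaMuI) (hN : Reaches M σ N) : LeftmostReduces M σ N :=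
  match h with
  | .nil M => .nil M
  | .lam (N := N) h =>
    have hN' : IsNormal N := fun R P hs =>
      hN.isNormal (fun _ => by simp) (fun _ _ => by simp) _ _ (.lam hs)
    (h.leftmostReduces hI.1 (.inl hN')).lam
  | .mu h hn => by
    rcases hN.mu with hσ | hN
    · exact .of_nil (Standard.mu h hn).reduces hσ
    · exact (h.leftmostReduces hI.1 (.inl fun R P hs => hN _ _ (.mu hs))).mu hn.notBefore
  | .muTheta h₁ hn hM' h₂ => by
    have hθ := isThetaRedex_mu_iff.2 ⟨_, rfl, hM'⟩
    have h₁' := h₁.reduces.lift (C := Term.mu) (p := [down]) .mu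
    have h₃ := h₁'.trans (.cons (.theta _ hM') (.nil _))
    refine ((h₁.leftmostReduces hI.1 (.inr (.inr ⟨hθ, hn⟩))).mu hn).trans
      (.cons (.theta hθ) (.theta _ hM') (h₂.leftmostReduces (h₃.isLambdaMuI hI) ?_))
    exact Reaches.suffix (by simpa using hN) h₃
  | .muKeep h₁ hn hM' h₂ => by
    rcases hN.mu with hσ | hN
    · exact .of_nil (Standard.muKeep h₁ hn hM' h₂).reduces hσ
    -- The kept θ-redex is still a redex in the final term, against normality.
    · have : ¬ FreeMu 0 _ := fun h0 => hM' (h₂.reduces.freeMu_of_freeMu h0)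
      exact absurd (Step.theta _ this) (hN _ _)
  | .named h hn => by
    rcases hN.named hI h.reduces with hσ | hN
    · exact .of_nil (Standard.named h hn).reduces hσ
    · exact (h.leftmostReduces hI (.inl fun R P hs => hN _ _ (.named _ hs))).named hn.notBefore
  | .namedRho (a := a) h₁ hn h₂ => by
    have h₁' := h₁.reduces.lift (C := Term.named a) (p := [down]) (.named a)
    have h₃ := h₁'.trans (.cons (.rho _ _) (.nil _))
    refine ((h₁.leftmostReduces hI (.inr (.inl ⟨a, _, rfl, hn⟩))).named hn).trans
      (.cons (.rho trivial) (.rho _ _) (h₂.leftmostReduces (h₃.isLambdaMuI hI) ?_))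
    exact Reaches.suffix (by simpa using hN) h₃
  | .namedKeep h₁ hn h₂ => by
    rcases hN.named hI (h₁.reduces.trans (h₂.reduces.lift (C := Term.mu) (p := [down]) .mu))
      with hσ | hN
    · exact .of_nil (Standard.namedKeep h₁ hn h₂).reduces hσ
    · exact absurd (Step.rho _ _) (hN _ _)
  | .headBeta (M₁ := M₁) (M₂ := M₂) (Ps := Ps) h =>
    have hs := (Step.beta M₁ M₂).apps_root Ps
    .cons (.headBeta _ _ _) hs (h.leftmostReduces (hs.isLambdaMuI hI)
      (Reaches.suffix (σ := [_]) hN (.cons hs (.nil _))))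
  | .headMu (M₁ := M₁) (M₂ := M₂) (Ps := Ps) h =>
    have hs := (Step.muRule M₁ M₂).apps_root Ps
    .cons (.headMu _ _ _) hs (h.leftmostReduces (hs.isLambdaMuI hI)
      (Reaches.suffix (σ := [_]) hN (.cons hs (.nil _))))
  | .compLam (Qs := Qs) hPs _ hs =>
    match Qs, hs.length_eq with
    | [], e => absurd (List.length_eq_zero_iff.1 e) hPs
    | _ :: _, _ =>
      absurd (hN.isNormal_of_isApp (apps_cons_isApp _ _ _)) (not_isNormal_apps_app (.beta _ _) _)
  | .compMu (Qs := Qs) hPs _ hs =>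
    match Qs, hs.length_eq with
    | [], e => absurd (List.length_eq_zero_iff.1 e) hPs
    | _ :: _, _ =>
      absurd (hN.isNormal_of_isApp (apps_cons_isApp _ _ _))
        (not_isNormal_apps_app (.muRule _ _) _)
  | .compVar (x := x) (Qs := Qs) hs => by
    have hn := hN.isNormal (fun P e => by simpa [e, IsNeutral] using isNeutral_apps_var x Qs)
      (fun a P e => by simpa [e, IsNeutral] using isNeutral_apps_var x Qs)
    exact hs.leftmostReduces (isLambdaMuI_apps.1 hI).2 (isNormal_of_apps hn).2 x []
      (by simp)

/-- The list `Ns` collects the arguments already normalized, so that the next one is the first that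
can contain the leftmost redex. -/
theorem StandardArgs.leftmostReduces {Ps Qs : List Term} {τ : List Occ}
    (h : StandardArgs Ps τ Qs) (hI : ∀ P ∈ Ps, P.IsLambdaMuI) (hQ : ∀ Q ∈ Qs, IsNormal Q)
    (x : ℕ) (Ns : List Term) (hNs : ∀ P ∈ Ns, IsNormal P) :
    LeftmostReduces (apps (var x) (Ns ++ Ps)) τ (apps (var x) (Ns ++ Qs)) :=
  match h with
  | .nil => .nil _
  | .cons (Q := Q) (Ps := Ps) h hs => by
    have hQ' : IsNormal Q := hQ Q (by simp)
    have h₁ := (h.leftmostReduces (hI _ (by simp)) (.inl hQ')).apps_arg x hNs Ps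
    have h₂ := hs.leftmostReduces (fun P hP => hI P (by simp [hP]))
      (fun P hP => hQ P (by simp [hP])) x (Ns ++ [Q])
      (fun P hP => by
        rcases List.mem_append.1 hP with hP | hP
        · exact hNs P hP
        · exact List.mem_singleton.1 hP ▸ hQ')
    simp only [List.append_assoc, List.singleton_append] at h₂
    exact h₁.trans h₂

end

end LambdaMu

-- The main theorem

theorem mainTheorem4 (M N : LambdaMu.Term) (σ : List LambdaMu.Occ)
    (hI : M.IsLambdaMuI) (hty : LambdaMu.Typable M) (hN : LambdaMu.IsNormal N)
    (hσ : LambdaMu.Standard M σ N) :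
    LambdaMu.LeftmostReduces M σ N ∧
      ∀ (P : LambdaMu.Term) (τ : List LambdaMu.Occ), LambdaMu.Reduces M τ P →
        τ.length ≤ σ.length := by
  have h := hσ.leftmostReduces hI (.inl hN)
  exact ⟨h, fun P τ hτ => (h.lmLength hN).length_le hI hτ⟩
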